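/- \textbf{Model.} A base station serves a finite set $\mathcal R$ of real-time (RT) users and a finite non-empty set $\mathcal N$ of non-real-time (NRT) users in slots $k=0,1,2,\dots$ of duration $T>0$; a packet has $L>0$ bits. At the beginning of slot $k$ it observes arrival indicators $a_i(k)\in\{0,1\}$ and on-off channel states $\gamma_i(k)\in\{0,1\}$, $i\in\mathcal R\cup\mathcal N$. The vectors $(a(k),\gamma(k))$ are independent and identically distributed over $k$ (no assumption is made on their law within a slot); $\lambda_i=\Pr(a_i(k)=1)$. A slot-based algorithm chooses in slot $k$, from the information available then (present and past observations, possibly extra randomization; information up to slot $k$ is independent of the observation of slot $k+1$), durations $\mu_i(k)$, powers $P_i(k)$ and, for $i\in\mathcal N$, admissions $r_i(k)\in\{0,1\}$. Put $R_i(k)=\log(1+P_i(k)\gamma_i(k))$. The NRT queues, started at given $Q_i(0)\ge0$, obey $Q_i(k+1)=(Q_i(k)+Lr_i(k)-\mu_i(k)R_i(k))^+$. The number of packets delivered in slot $k$ is $D_i(k)=\mu_i(k)R_i(k)/L$ for $i\in\mathcal R$ and $D_i(k)=\min\{\mu_i(k)R_i(k),\,Q_i(k)+Lr_i(k)\}/L$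 for $i\in\mathcal N$. \textbf{Problem.} Given $P_{\max},P_{\rm avg}\ge0$ and $q_i\in[0,1]$ ($i\in\mathcal R$), maximize the NRT sum throughput $$\liminf_{K\to\infty}\frac1K\sum_{k<K}\sum_{i\in\mathcal N}\mathbb E[D_i(k)]$$ over slot-based algorithms subject to: $r_i(k)\le a_i(k)$ and $\limsup_{k}\mathbb E[Q_i(k)]<\infty$ for $i\in\mathcal N$; $\liminf_K\frac1K\sum_{k<K}\mathbb E[D_i(k)]\ge\lambda_iq_i$ for $i\in\mathcal R$; $\limsup_K\frac1K\sum_{k<K}\mathbb E[\frac1T\sum_iP_i(k)\mu_i(k)]\le P_{\rm avg}$; $0\le P_i(k)\le P_{\max}$, $0\le\mu_i(k)\le T$, $\sum_i\mu_i(k)=T$; and, for $i\in\mathcal R$, $\mu_i(k)\neq0$ only if $a_i(k)=1$ and $\mu_i(k)R_i(k)=L$. Let $\theta^*$ be the supremum of the sum throughput over the algorithms that satisfy these constraints. \textbf{Algorithm 1 (parameter $B>0$).} Besides $Q$ it keeps virtual queues, with arbitrary initial values $\ge0$, $Y_i(k+1)=(Y_i(k)+a_i(k)q_i-\mathbf 1[\mu_i(k)\ne0])^+$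 for $i\in\mathcal R$ and $X(k+1)=(X(k)+\frac1T\sum_iP_i(k)\mu_i(k)-P_{\rm avg})^+$. In each slot (index $k$ omitted; ties broken arbitrarily): (1) let $i^*$ be an NRT user with longest queue among those with $\gamma_i=1$, let $P_{i^*}=\min\{(TQ_{i^*}/X-1)^+,P_{\max}\}$ and $\Psi=Q_{i^*}\log(1+P_{i^*})-XP_{i^*}/T$; if no NRT user has $\gamma_i=1$, let $i^*\in\mathcal N$ be arbitrary, $P_{i^*}=0$, $\Psi=0$. (2) For $n\ge1$ let $z=T\Psi/X-1$ and $p=\min\{z/W_0(z/e)-1,P_{\max}\}$, where $W_0$ is the principal branch of the Lambert function; let $p_n=p$ if $p>0$ and $nL/\log(1+p)\le T$, and $p_n=e^{nL/T}-1$ otherwise; let $m_n=L/\log(1+p_n)$. The expressions in (1) and (2) are read as their limits $X\downarrow0$ if $X=0$ and $z\to0$ if $z=0$. (3) A candidate set is a (possibly empty) set $S$ of RT users with $a_i=\gamma_i=1$ such that $Y_i\ge Y_j$ for all $i\in S$ and all $j\notin S$ with $a_j=\gamma_j=1$, and $p_{|S|}\le P_{\max}$ if $S\neq\emptyset$. Choose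 a candidate set $S$ maximizing $\sum_{i\in S}\big(Y_i-Xp_{|S|}m_{|S|}/T\big)+\Psi\,(T-|S|m_{|S|})$, with $|S|m_{|S|}=0$ for $S=\emptyset$. (4) Set $P_i=p_{|S|}$, $\mu_i=m_{|S|}$ for $i\in S$; $\mu_{i^*}=T-|S|m_{|S|}$; all other durations and powers are $0$; for $i\in\mathcal N$ set $r_i=a_i$ if $Q_i<B$ and $r_i=0$ otherwise. \textbf{Theorem.} Suppose that some slot-based algorithm satisfies all constraints of the problem. Then for every $B>0$ Algorithm 1 can be run as a slot-based algorithm, and every run of it (whatever the tie-breaking) satisfies all constraints of the problem; moreover the delivery-ratio constraint and the average-power constraint also hold almost surely without the expectations. Its NRT sum throughput is at least $$\theta^*-\frac{C_1}{LB},\qquad C_1=\frac12\Big(\sum_{i\in\mathcal R}(q_i^2+1)+P_{\max}^2+P_{\rm avg}^2+|\mathcal N|\big(L^2+T^2\log^2(1+P_{\max})\big)\Big).$$ -/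

import Mathlib

open MeasureTheory ProbabilityTheory Filter

noncomputable section

namespace RTNRT

/-- The constants of the downlink system with real-time (RT) users `R` and non-real-time (NRT)
users: packet length `L`, slot duration `T`, maximal power, average power budget, and the
required delivery ratios `q` of the RT users. -/
structure Params (R : Type*) where
  L : ℝ
  T : ℝ
  Pmax : ℝ
  Pavg : ℝ
  q : R → ℝ
  L_pos : 0 < L
  T_pos : 0 < T
  Pmax_nonneg : 0 ≤ Pmax
  Pavg_nonneg : 0 ≤ Pavg
  q_nonneg : ∀ i, 0 ≤ q i
  q_le_one : ∀ i, q i ≤ 1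

/-- What the base station observes at the beginning of a slot: the packet arrival indicators
`a_i` (first component) and the on-off channel states `γ_i` (second component). -/
abbrev Slot (R N : Type*) := (R ⊕ N → Bool) × (R ⊕ N → Bool)

/-- The decisions of one slot: durations `μ_i`, powers `P_i`, and admissions `r_i`. -/
structure Action (R N : Type*) where
  dur : R ⊕ N → ℝ
  pow : R ⊕ N → ℝ
  adm : N → Bool

/-- The queues: virtual delivery queues `Y_i`, data queues `Q_i`, virtual power queue `X`. -/
structure State (R N : Type*) where
  Y : R → ℝ
  Q : N → ℝ
  X : ℝ

def State.Nonneg {R N : Type*} (u : State R N) : Prop :=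
  (∀ i, 0 ≤ u.Y i) ∧ (∀ i, 0 ≤ u.Q i) ∧ 0 ≤ u.X

/-- `{true, false}` read as `{1, 0}`. -/
def ind (b : Bool) : ℝ := if b then 1 else 0

section Model

variable {R N : Type*} [Fintype R] [Fintype N]

/-- Transmission rate `R_i = log (1 + P_i γ_i)`. -/
def rate (s : Slot R N) (d : Action R N) (j : R ⊕ N) : ℝ :=
  Real.log (1 + d.pow j * ind (s.2 j))

/-- Power spent in a slot, averaged over the slot: `(∑ i, P_i μ_i) / T`. -/
def slotPower (p : Params R) (d : Action R N) : ℝ :=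
  (∑ j, d.pow j * d.dur j) / p.T

/-- Bits delivered to a user in a slot. For an RT user this is `μ_i R_i` (`L` if it is scheduled,
`0` otherwise); for an NRT user it is `μ_i R_i`, limited by the data present in the buffer. -/
def bits (p : Params R) (u : State R N) (s : Slot R N) (d : Action R N) : R ⊕ N → ℝ
  | Sum.inl i => d.dur (Sum.inl i) * rate s d (Sum.inl i)
  | Sum.inr i => min (d.dur (Sum.inr i) * rate s d (Sum.inr i)) (u.Q i + p.L * ind (d.adm i))

open Classical in
/-- One-slot evolution of the data queues and of the virtual queues. -/
def step (p : Params R) (u : State R N) (s : Slot R N) (d : Action R N) : State R N where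
  Y i := max (u.Y i + ind (s.1 (Sum.inl i)) * p.q i
    - (if d.dur (Sum.inl i) ≠ 0 then 1 else 0)) 0
  Q i := max (u.Q i + p.L * ind (d.adm i)
    - d.dur (Sum.inr i) * rate s d (Sum.inr i)) 0
  X := max (u.X + slotPower p d - p.Pavg) 0

/-- The per-slot constraints. A scheduled RT user (`μ_i ≠ 0`) must have received a packet in this
slot, and it is served for exactly the time `μ_i = L / R_i` that its packet needs. -/
structure Action.Valid (p : Params R) (s : Slot R N) (d : Action R N) : Prop where
  adm_le : ∀ i : N, d.adm i = true → s.1 (Sum.inr i) = true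
  pow_mem : ∀ j, d.pow j ∈ Set.Icc 0 p.Pmax
  dur_mem : ∀ j, d.dur j ∈ Set.Icc 0 p.T
  sum_dur : ∑ j, d.dur j = p.T
  rt : ∀ i : R, d.dur (Sum.inl i) ≠ 0 →
    s.1 (Sum.inl i) = true ∧ d.dur (Sum.inl i) * rate s d (Sum.inl i) = p.L

variable {Ω : Type*}

/-- The queues at the beginning of each slot, starting at `u₀`, when the decisions `π` are used. -/
def queues (p : Params R) (u₀ : State R N) (obs : ℕ → Ω → Slot R N) (π : ℕ → Ω → Action R N) :
    ℕ → Ω → State R N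
  | 0, _ => u₀
  | k + 1, ω => step p (queues p u₀ obs π k ω) (obs k ω) (π k ω)

/-- Packets delivered to user `j` in slot `k`. -/
def packets (p : Params R) (u₀ : State R N) (obs : ℕ → Ω → Slot R N) (π : ℕ → Ω → Action R N)
    (j : R ⊕ N) (k : ℕ) (ω : Ω) : ℝ :=
  bits p (queues p u₀ obs π k ω) (obs k ω) (π k ω) j / p.L

/-- Average of the first `K` terms of a sequence. -/
def timeAvg (f : ℕ → ℝ) (K : ℕ) : ℝ := (∑ k ∈ Finset.range K, f k) / K

/-- The on-off model: arrivals and channel states are known at the beginning of their slot, they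
are independent and identically distributed over the slots, and RT user `i` receives a packet
with probability `lam i`. The `σ`-algebra `ℱ k` is the information that is available for the
decisions in slot `k`; it may include additional randomization. -/
structure IsOnOffModel [mΩ : MeasurableSpace Ω] (μ : Measure Ω) (ℱ : Filtration ℕ mΩ)
    (obs : ℕ → Ω → Slot R N) (lam : R → ℝ) : Prop where
  measurable : ∀ k, Measurable[ℱ k] (obs k)
  indep : ∀ k, Indep (MeasurableSpace.comap (obs (k + 1)) inferInstance) (ℱ k) μ
  identDistrib : ∀ k, IdentDistrib (obs k) (obs 0) μ μ
  arrival : ∀ i, μ.real {ω | (obs 0 ω).1 (Sum.inl i) = true} = lam i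

/-- A slot-based algorithm: the decisions of slot `k` are taken with the information `ℱ k`. -/
structure IsPolicy [mΩ : MeasurableSpace Ω] (ℱ : Filtration ℕ mΩ)
    (π : ℕ → Ω → Action R N) : Prop where
  dur : ∀ k j, Measurable[ℱ k] fun ω => (π k ω).dur j
  pow : ∀ k j, Measurable[ℱ k] fun ω => (π k ω).pow j
  adm : ∀ k i, Measurable[ℱ k] fun ω => (π k ω).adm i

/-- Slot-based algorithms that satisfy all constraints of the throughput problem. -/
structure IsFeasible [mΩ : MeasurableSpace Ω] (μ : Measure Ω) (ℱ : Filtration ℕ mΩ)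
    (p : Params R) (lam : R → ℝ) (u₀ : State R N) (obs : ℕ → Ω → Slot R N)
    (π : ℕ → Ω → Action R N) : Prop where
  policy : IsPolicy ℱ π
  valid : ∀ k ω, (π k ω).Valid p (obs k ω)
  stable : ∀ i : N,
    limsup (fun k => ((∫ ω, (queues p u₀ obs π k ω).Q i ∂μ : ℝ) : EReal)) atTop < ⊤
  delivery : ∀ i : R, lam i * p.q i ≤
    liminf (timeAvg fun k => ∫ ω, packets p u₀ obs π (Sum.inl i) k ω ∂μ) atTop
  power : limsup (timeAvg fun k => ∫ ω, slotPower p (π k ω) ∂μ) atTop ≤ p.Pavg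

/-- The NRT sum throughput in packets per slot. -/
def sumThroughput [MeasurableSpace Ω] (μ : Measure Ω) (p : Params R) (u₀ : State R N)
    (obs : ℕ → Ω → Slot R N) (π : ℕ → Ω → Action R N) : ℝ :=
  liminf (timeAvg fun k => ∑ i : N, ∫ ω, packets p u₀ obs π (Sum.inr i) k ω ∂μ) atTop

/-- The optimal NRT sum throughput. -/
def optThroughput [mΩ : MeasurableSpace Ω] (μ : Measure Ω) (ℱ : Filtration ℕ mΩ)
    (p : Params R) (lam : R → ℝ) (u₀ : State R N) (obs : ℕ → Ω → Slot R N) : ℝ :=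
  sSup (sumThroughput μ p u₀ obs '' {π | IsFeasible μ ℱ p lam u₀ obs π})

/-- The constant `C₁`, with `Rmax = log (1 + Pmax)`. -/
def C1 (p : Params R) (N : Type*) [Fintype N] : ℝ :=
  (∑ i, (p.q i ^ 2 + 1) + p.Pmax ^ 2 + p.Pavg ^ 2
    + Fintype.card N * (p.L ^ 2 + p.T ^ 2 * Real.log (1 + p.Pmax) ^ 2)) / 2

end Model

section Algorithm

/-- Principal branch of the Lambert `W` function: the inverse of `w ↦ w * exp w` on `[-1, ∞)`. -/
def lambertW0 (z : ℝ) : ℝ := Function.invFunOn (fun w => w * Real.exp w) (Set.Ici (-1)) z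

variable {R N : Type*}

/-- Water-filling power `min ((T Q_i / X - 1)⁺, Pmax)` of an NRT user with channel on, read as its
limit from the right at `X = 0`. A user with channel off transmits nothing. -/
def nrtPower (p : Params R) (u : State R N) (s : Slot R N) (i : N) : ℝ :=
  if s.2 (Sum.inr i) = false then 0
  else if u.X = 0 then (if u.Q i = 0 then 0 else p.Pmax)
  else min (max (p.T * u.Q i / u.X - 1) 0) p.Pmax

/-- `Ψ_NR(i) = Q_i R_i - X P_i / T` at the water-filling power. -/
def psiNR (p : Params R) (u : State R N) (s : Slot R N) (i : N) : ℝ :=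
  u.Q i * Real.log (1 + nrtPower p u s i * ind (s.2 (Sum.inr i))) - u.X * nrtPower p u s i / p.T

/-- `i` has the longest queue among the NRT users with channel on. If there is no such user, `i` is
arbitrary (its power is `0`, so the time that it is given is idle time). -/
def IsLongest (u : State R N) (s : Slot R N) (i : N) : Prop :=
  (s.2 (Sum.inr i) = true ∧ ∀ j, s.2 (Sum.inr j) = true → u.Q j ≤ u.Q i) ∨
    ∀ j : N, s.2 (Sum.inr j) = false

/-- Lambert power `min (z / W₀(z / e) - 1, Pmax)` with `z = T ψ / X - 1`, read as its limit at
`z = 0`, and as its limit from the right at `X = 0`. -/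
def lambertPower (p : Params R) (X ψ : ℝ) : ℝ :=
  if X = 0 then (if ψ = 0 then 0 else p.Pmax)
  else
    let z := p.T * ψ / X - 1
    min ((if z = 0 then Real.exp 1 else z / lambertW0 (z / Real.exp 1)) - 1) p.Pmax

open Classical in
/-- Power of each of `n` scheduled RT users: the Lambert power if the `n` packets then fit into the
slot (zero power needs infinite time and never fits), otherwise the power at which they fill the
slot exactly. -/
def rtPower (p : Params R) (X ψ : ℝ) (n : ℕ) : ℝ :=
  if 0 < lambertPower p X ψ ∧ n * (p.L / Real.log (1 + lambertPower p X ψ)) ≤ p.T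
  then lambertPower p X ψ
  else Real.exp (n * p.L / p.T) - 1

/-- Duration `L / R_i` of the transmission to each of `n` scheduled RT users. -/
def rtDur (p : Params R) (X ψ : ℝ) (n : ℕ) : ℝ :=
  p.L / Real.log (1 + rtPower p X ψ n)

/-- Candidate sets of RT users: all members have a packet and channel on, no other such user has a
larger `Y`, and the power that the set needs does not exceed the maximal power. -/
structure IsCandidate (p : Params R) (u : State R N) (s : Slot R N) (ψ : ℝ)
    (S : Finset R) : Prop where
  eligible : ∀ i ∈ S, s.1 (Sum.inl i) = true ∧ s.2 (Sum.inl i) = true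
  largest : ∀ i ∈ S, ∀ j ∉ S, s.1 (Sum.inl j) = true → s.2 (Sum.inl j) = true → u.Y j ≤ u.Y i
  pow_le : rtPower p u.X ψ S.card ≤ p.Pmax

/-- The value of a candidate set: `∑_{i ∈ S} (Y_i - X P_i μ_i / T)` plus `ψ` times the time that is
left for the NRT user. -/
def psiAux (p : Params R) (u : State R N) (ψ : ℝ) (S : Finset R) : ℝ :=
  ∑ i ∈ S, (u.Y i - u.X * rtPower p u.X ψ S.card * rtDur p u.X ψ S.card / p.T)
    + ψ * (p.T - S.card * rtDur p u.X ψ S.card)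

open Classical in
/-- `d` is a decision of the scheduling and power allocation algorithm with control parameter `B`
for queues `u` and observation `s`. Ties may be broken in any way. -/
def IsAlgDecision (p : Params R) (B : ℝ) (u : State R N) (s : Slot R N) (d : Action R N) : Prop :=
  ∃ (i₀ : N) (S : Finset R),
    IsLongest u s i₀ ∧
    IsCandidate p u s (psiNR p u s i₀) S ∧
    (∀ S', IsCandidate p u s (psiNR p u s i₀) S' →
      psiAux p u (psiNR p u s i₀) S' ≤ psiAux p u (psiNR p u s i₀) S) ∧
    (∀ i : R, d.pow (Sum.inl i) = if i ∈ S then rtPower p u.X (psiNR p u s i₀) S.card else 0) ∧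
    (∀ i : R, d.dur (Sum.inl i) = if i ∈ S then rtDur p u.X (psiNR p u s i₀) S.card else 0) ∧
    (∀ i : N, d.pow (Sum.inr i) = if i = i₀ then nrtPower p u s i₀ else 0) ∧
    (∀ i : N, d.dur (Sum.inr i) =
      if i = i₀ then p.T - S.card * rtDur p u.X (psiNR p u s i₀) S.card else 0) ∧
    (∀ i : N, d.adm i = if u.Q i < B then s.1 (Sum.inr i) else false)

/-- `π` is an execution of the algorithm with control parameter `B`. -/
structure IsAlgorithm [Fintype R] [Fintype N] {Ω : Type*} [mΩ : MeasurableSpace Ω]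
    (ℱ : Filtration ℕ mΩ) (p : Params R) (B : ℝ) (u₀ : State R N) (obs : ℕ → Ω → Slot R N)
    (π : ℕ → Ω → Action R N) : Prop where
  policy : IsPolicy ℱ π
  decision : ∀ k ω, IsAlgDecision p B (queues p u₀ obs π k ω) (obs k ω) (π k ω)

end Algorithm

end RTNRT

end

set_option linter.unusedSectionVars false

namespace RTNRT

/-! ### The principal branch of the Lambert function -/

/-! This is a Lyapunov drift-plus-penalty argument. Regard `Y`, `Q` and `X` as one vector of queues.
In one slot, half its squared norm grows by at most `C1` minus the inner product of the queue levels
with the surplus of service over arrivals (`lyapunov_step_le`). Give a reward `B * L` for each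
admitted packet. The part of the bound that the decision influences is then `-gain`, and the
algorithm maximizes `gain` over all valid decisions (`IsAlgDecision.valid_and_gain_le`).

That maximization is deterministic. For NRT users the best return per unit of time is `ψ`, obtained
by water-filling on the longest usable queue (`le_psiNR_of_isLongest`). Thus `ψ` is the price of
time for RT users. The energy needed to send `L` bits is a convex function of the duration, and the
critical point of energy cost plus time cost is a Lambert expression (`rtPower_optimal`). This cost
depends only on how many RT users are served, so for each number the users with the largest `Y` are
best (`exists_top_set`).

The comparison needs no stationary policy and no slack in the constraints. The queues at the start
of slot `k` are independent of its observation, so the algorithm in slot `k` can be compared with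
any feasible policy in any slot `j` (`sum_integral_mul_integral_le`, `IsAlgorithm.drift_le`). With
`k` fixed, average over `j`: in the long run the competitor's mean surplus is nonnegative for every
queue and its admission rate is at least its throughput. Hence its throughput enters the drift
inequality of each single slot (`IsAlgorithm.drift_le_of_isFeasible`).

Summing over `k` bounds the admission rate from below. It also shows that second moments of the
queues grow at most linearly. Since increments are bounded, every queue is sublinear almost surely
and in mean, which gives the delivery and power constraints. Admission control bounds the data
queues, so admitted and delivered packets have the same long-run rate. Finally, a measurable run
exists because each decision selects from finitely many choices. -/

lemma exists_mul_exp_eq {z : ℝ} (hz : -1 ≤ z) :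
    ∃ w ∈ Set.Ici (-1 : ℝ), w * Real.exp w = z / Real.exp 1 := by
  have hc : ContinuousOn (fun w : ℝ => w * Real.exp w) (Set.Icc (-1) |z|) := by fun_prop
  have h0 : (-1 : ℝ) ≤ |z| := by linarith [abs_nonneg z]
  have hmem : z / Real.exp 1 ∈ Set.Icc ((-1 : ℝ) * Real.exp (-1)) (|z| * Real.exp |z|) := by
    have he : Real.exp (-1 : ℝ) = 1 / Real.exp 1 := by rw [Real.exp_neg, one_div]
    constructor
    · rw [he, mul_one_div]
      gcongr
    · have h1 : z / Real.exp 1 ≤ |z| := by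
        rw [div_le_iff₀ (Real.exp_pos 1)]
        have : (1 : ℝ) ≤ Real.exp 1 := Real.one_le_exp zero_le_one
        nlinarith [le_abs_self z, abs_nonneg z]
      have h2 : (1 : ℝ) ≤ Real.exp |z| := Real.one_le_exp (abs_nonneg z)
      nlinarith [abs_nonneg z]
  obtain ⟨w, hw, hwz⟩ := intermediate_value_Icc h0 hc hmem
  exact ⟨w, hw.1, hwz⟩

lemma lambertW0_spec {z : ℝ} (hz : -1 ≤ z) :
    -1 ≤ lambertW0 (z / Real.exp 1) ∧
      lambertW0 (z / Real.exp 1) * Real.exp (lambertW0 (z / Real.exp 1)) = z / Real.exp 1 := by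
  have h := exists_mul_exp_eq hz
  exact ⟨Function.invFunOn_mem h, Function.invFunOn_eq h⟩

/-- For `X > 0` the uncapped Lambert power is `exp y - 1`, where `y` is a critical point of the
cost of serving an RT user. -/
lemma lambertPower_spec {R : Type*} (p : Params R) {X ψ : ℝ} (hX : 0 < X) (hψ : 0 ≤ ψ) :
    ∃ y, 0 ≤ y ∧ X / p.T * (Real.exp y * (1 - y) - 1) + ψ = 0 ∧
      lambertPower p X ψ = min (Real.exp y - 1) p.Pmax := by
  have hT := p.T_pos
  have hz : -1 ≤ p.T * ψ / X - 1 := by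
    have : 0 ≤ p.T * ψ / X := by positivity
    linarith
  obtain ⟨h1, h2⟩ := lambertW0_spec hz
  set z := p.T * ψ / X - 1 with hzdef
  set w := lambertW0 (z / Real.exp 1) with hw
  have hexp : Real.exp (1 + w) * w = z := by
    rw [Real.exp_add, mul_assoc, mul_comm (Real.exp w), h2]
    field_simp
  -- The critical equation reads `exp y * (y - 1) = z`, so `y - 1` is a Lambert value at `z / e`.
  -- The principal branch is the one that makes `y` nonnegative.
  refine ⟨1 + w, by linarith, ?_, ?_⟩
  · have : Real.exp (1 + w) * (1 - (1 + w)) = -z := by linarith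
    rw [this, hzdef]
    field_simp
    ring
  · unfold lambertPower
    rw [if_neg hX.ne']
    simp only [← hzdef, ← hw]
    congr 2
    split_ifs with h0
    · have : w = 0 := by
        rcases mul_eq_zero.1 (hexp.trans h0) with h | h
        · exact absurd h (Real.exp_pos _).ne'
        · exact h
      rw [this, add_zero]
    · have : w ≠ 0 := by
        rintro h
        rw [h, mul_zero] at hexp
        exact h0 hexp.symm
      rw [← hexp]
      field_simp

/-! ### The power of the scheduled RT users -/

section Powers

variable {R N : Type*} (p : Params R)

lemma lambertPower_nonneg {X ψ : ℝ} (hX : 0 ≤ X) (hψ : 0 ≤ ψ) : 0 ≤ lambertPower p X ψ := by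
  rcases hX.eq_or_lt with rfl | hX
  · unfold lambertPower
    rw [if_pos rfl]
    split_ifs
    · exact le_rfl
    · exact p.Pmax_nonneg
  · obtain ⟨y, hy, -, h⟩ := lambertPower_spec p hX hψ
    rw [h]
    exact le_min (by linarith [Real.one_le_exp hy]) p.Pmax_nonneg

lemma lambertPower_le {X ψ : ℝ} (hX : 0 ≤ X) (hψ : 0 ≤ ψ) : lambertPower p X ψ ≤ p.Pmax := by
  rcases hX.eq_or_lt with rfl | hX
  · unfold lambertPower
    rw [if_pos rfl]
    split_ifs
    · exact p.Pmax_nonneg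
    · exact le_rfl
  · obtain ⟨y, hy, -, h⟩ := lambertPower_spec p hX hψ
    rw [h]
    exact min_le_right _ _

lemma rtPower_pos {X ψ : ℝ} {n : ℕ} (hn : n ≠ 0) : 0 < rtPower p X ψ n := by
  unfold rtPower
  split_ifs with h
  · exact h.1
  · have hT := p.T_pos
    have hL := p.L_pos
    have : 0 < (n : ℝ) * p.L / p.T := by positivity
    linarith [Real.add_one_lt_exp this.ne']

lemma rtPower_zero_le {X ψ : ℝ} (hX : 0 ≤ X) (hψ : 0 ≤ ψ) : rtPower p X ψ 0 ≤ p.Pmax := by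
  unfold rtPower
  split_ifs with h
  · exact lambertPower_le p hX hψ
  · simpa using p.Pmax_nonneg

lemma log_rtPower_pos {X ψ : ℝ} {n : ℕ} (hn : n ≠ 0) : 0 < Real.log (1 + rtPower p X ψ n) :=
  Real.log_pos (by linarith [rtPower_pos p (X := X) (ψ := ψ) hn])

lemma rtDur_pos {X ψ : ℝ} {n : ℕ} (hn : n ≠ 0) : 0 < rtDur p X ψ n :=
  div_pos p.L_pos (log_rtPower_pos p hn)

lemma rtDur_mul_log {X ψ : ℝ} {n : ℕ} (hn : n ≠ 0) :
    rtDur p X ψ n * Real.log (1 + rtPower p X ψ n) = p.L :=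
  div_mul_cancel₀ _ (log_rtPower_pos p hn).ne'

lemma card_mul_rtDur_le (X ψ : ℝ) (n : ℕ) : n * rtDur p X ψ n ≤ p.T := by
  have hT := p.T_pos
  have hL := p.L_pos
  rcases eq_or_ne n 0 with rfl | hn
  · simpa using hT.le
  · unfold rtDur rtPower
    split_ifs with h
    · exact h.2
    · have h0 : (n : ℝ) ≠ 0 := by exact_mod_cast hn
      rw [add_sub_cancel, Real.log_exp]
      apply le_of_eq
      field_simp

lemma card_mul_rtDur_nonneg (X ψ : ℝ) (n : ℕ) : 0 ≤ n * rtDur p X ψ n := by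
  rcases eq_or_ne n 0 with rfl | hn
  · simp
  · have := rtDur_pos p (X := X) (ψ := ψ) hn
    positivity

/-- The derivative of `x ↦ exp x * (1 - x)` is `-x * exp x`. The proof avoids calculus by using `1 +
(a - b) ≤ exp (a - b)`. -/
lemma exp_mul_one_sub_antitone {a b : ℝ} (ha : 0 ≤ a) (hab : a ≤ b) :
    Real.exp b * (1 - b) ≤ Real.exp a * (1 - a) := by
  have h1 : Real.exp b * (a - b + 1) ≤ Real.exp a := by
    calc Real.exp b * (a - b + 1) ≤ Real.exp b * Real.exp (a - b) := by
          gcongr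
          exact Real.add_one_le_exp _
      _ = Real.exp a := by rw [← Real.exp_add]; congr 1; ring
  have h2 : Real.exp a ≤ Real.exp b := Real.exp_le_exp.2 hab
  nlinarith [mul_le_mul_of_nonneg_left h2 ha]

/-- Derivative, with respect to the duration, of the cost `X P μ / T + ψ μ` of serving an RT user
at rate `y`. -/
noncomputable def costSlope (X ψ y : ℝ) : ℝ := X / p.T * (Real.exp y * (1 - y) - 1) + ψ

lemma costSlope_antitone {X ψ a b : ℝ} (hX : 0 ≤ X) (ha : 0 ≤ a) (hab : a ≤ b) :
    costSlope p X ψ b ≤ costSlope p X ψ a := by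
  unfold costSlope
  have := p.T_pos
  have := exp_mul_one_sub_antitone ha hab
  gcongr

/-- At power `exp (n L / T) - 1` the packets fill the slot exactly, and more power only shortens
them. So the fallback branch of `rtPower` is reached only if the Lambert power lies below this
threshold. -/
lemma fits_of_le {P : ℝ} {n : ℕ} (hn : n ≠ 0) (h : Real.exp (n * p.L / p.T) - 1 ≤ P) :
    0 < P ∧ n * (p.L / Real.log (1 + P)) ≤ p.T := by
  have hT := p.T_pos
  have hL := p.L_pos
  have hpos : 0 < (n : ℝ) * p.L / p.T := by positivity
  have hP : 0 < P := by linarith [Real.add_one_lt_exp hpos.ne']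
  refine ⟨hP, ?_⟩
  have hlog : n * p.L / p.T ≤ Real.log (1 + P) := by
    rw [Real.le_log_iff_exp_le (by linarith)]
    linarith
  rw [div_le_iff₀ hT] at hlog
  rw [← mul_div_assoc, div_le_iff₀ (Real.log_pos (by linarith))]
  linarith

/-- Optimality conditions for the power of `n` RT users. -/
lemma costSlope_rtPower {X ψ : ℝ} {n : ℕ} (hn : n ≠ 0) (hX : 0 ≤ X) (hψ : 0 ≤ ψ)
    (hle : rtPower p X ψ n ≤ p.Pmax) :
    costSlope p X ψ (Real.log (1 + rtPower p X ψ n)) = 0 ∨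
    (0 ≤ costSlope p X ψ (Real.log (1 + rtPower p X ψ n)) ∧ rtPower p X ψ n = p.Pmax) ∨
    (costSlope p X ψ (Real.log (1 + rtPower p X ψ n)) ≤ 0 ∧
      Real.log (1 + rtPower p X ψ n) = n * p.L / p.T) := by
  have hT := p.T_pos
  have hL := p.L_pos
  rcases hX.eq_or_lt with rfl | hX
  · rcases hψ.eq_or_lt with rfl | hψ
    · left
      simp [costSlope]
    · have hl : lambertPower p 0 ψ = p.Pmax := by
        unfold lambertPower
        rw [if_pos rfl, if_neg hψ.ne']
      right; left
      refine ⟨by simpa [costSlope] using hψ.le, ?_⟩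
      unfold rtPower at hle ⊢
      rw [hl] at hle ⊢
      split_ifs at hle ⊢ with h
      · rfl
      -- If the slot-filling power is at most `Pmax`, then the packets fit at `Pmax`, and the
      -- fallback would not have been used.
      · exact absurd (fits_of_le p hn hle) h
  · obtain ⟨y, hy, hys, hyl⟩ := lambertPower_spec p hX hψ
    change costSlope p X ψ y = 0 at hys
    have hl0 := lambertPower_nonneg p hX.le hψ
    have hly : Real.log (1 + lambertPower p X ψ) ≤ y := by
      rw [Real.log_le_iff_le_exp (by linarith), hyl]
      linarith [min_le_left (Real.exp y - 1) p.Pmax]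
    by_cases h : 0 < lambertPower p X ψ ∧
        n * (p.L / Real.log (1 + lambertPower p X ψ)) ≤ p.T
    · have hr : rtPower p X ψ n = lambertPower p X ψ := by unfold rtPower; rw [if_pos h]
      rw [hr]
      rcases le_total (Real.exp y - 1) p.Pmax with hc | hc
      · left
        rw [hyl, min_eq_left hc, add_sub_cancel, Real.log_exp, hys]
      · right; left
        refine ⟨?_, by rw [hyl, min_eq_right hc]⟩
        rw [← hys]
        exact costSlope_antitone p hX.le (Real.log_nonneg (by linarith)) hly
    · have hr : rtPower p X ψ n = Real.exp (n * p.L / p.T) - 1 := by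
        unfold rtPower; rw [if_neg h]
      right; right
      have hlog : Real.log (1 + rtPower p X ψ n) = n * p.L / p.T := by
        rw [hr, add_sub_cancel, Real.log_exp]
      refine ⟨?_, hlog⟩
      rw [hlog, ← hys]
      refine costSlope_antitone p hX.le hy ?_
      -- Otherwise the slot-filling power lies below both `exp y - 1` and `Pmax`, hence below the
      -- Lambert power, which would then fit.
      by_contra! hlt
      apply h
      apply fits_of_le p hn
      rw [hyl]
      exact le_min (by linarith [Real.exp_lt_exp.2 hlt]) (hr ▸ hle)

/-- Serving a packet with power `P` for the time `m` that it needs costs at least as much as the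
tangent at rate `y` predicts. -/
lemma tangent_le {m P y : ℝ} (hm : 0 ≤ m) (hP : 0 ≤ P) (hmP : m * Real.log (1 + P) = p.L) :
    p.L * Real.exp y + m * (Real.exp y * (1 - y) - 1) ≤ P * m := by
  have h : Real.exp y * (Real.log (1 + P) - y + 1) ≤ 1 + P := by
    calc Real.exp y * (Real.log (1 + P) - y + 1)
        ≤ Real.exp y * Real.exp (Real.log (1 + P) - y) := by
          gcongr
          exact Real.add_one_le_exp _
      _ = 1 + P := by
          rw [← Real.exp_add, add_sub_cancel, Real.exp_log (by linarith)]
  rw [← hmP]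
  linarith [mul_le_mul_of_nonneg_left h hm]

lemma tangent_eq {m P : ℝ} (hP : 0 ≤ P) (hmP : m * Real.log (1 + P) = p.L) :
    p.L * Real.exp (Real.log (1 + P)) +
      m * (Real.exp (Real.log (1 + P)) * (1 - Real.log (1 + P)) - 1) = P * m := by
  rw [Real.exp_log (by linarith), ← hmP]
  ring

/-- Among all ways to serve `n` RT users, the common power `rtPower` has least cost. -/
lemma rtPower_optimal {X ψ : ℝ} (hX : 0 ≤ X) (hψ : 0 ≤ ψ) (S : Finset R) (P m : R → ℝ)
    (hm : ∀ i ∈ S, 0 ≤ m i) (hP : ∀ i ∈ S, P i ∈ Set.Icc 0 p.Pmax)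
    (hmP : ∀ i ∈ S, m i * Real.log (1 + P i) = p.L) (hsum : ∑ i ∈ S, m i ≤ p.T) :
    rtPower p X ψ S.card ≤ p.Pmax ∧
    S.card * (X * rtPower p X ψ S.card * rtDur p X ψ S.card / p.T + ψ * rtDur p X ψ S.card) ≤
      ∑ i ∈ S, (X * (P i * m i) / p.T + ψ * m i) := by
  have hT := p.T_pos
  have hL := p.L_pos
  rcases S.eq_empty_or_nonempty with rfl | hS
  · simpa using rtPower_zero_le p hX hψ
  have hn : S.card ≠ 0 := hS.card_ne_zero
  -- Even at full power each packet needs time `L / log (1 + Pmax)`. As all of them fit into the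
  -- slot, the slot-filling power is at most `Pmax`, so a set of this size passes the power test.
  have hm_ge : ∀ i ∈ S, p.L ≤ m i * Real.log (1 + p.Pmax) := fun i hi => by
    rw [← hmP i hi]
    have := (hP i hi).1
    have := (hP i hi).2
    have := hm i hi
    gcongr
  have hn_le : S.card * p.L / p.T ≤ Real.log (1 + p.Pmax) := by
    rw [div_le_iff₀ hT]
    calc S.card * p.L = ∑ i ∈ S, p.L := by simp
      _ ≤ ∑ i ∈ S, m i * Real.log (1 + p.Pmax) := Finset.sum_le_sum hm_ge
      _ = (∑ i ∈ S, m i) * Real.log (1 + p.Pmax) := by rw [Finset.sum_mul]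
      _ ≤ p.T * Real.log (1 + p.Pmax) := by
          have := Real.log_nonneg (by linarith [p.Pmax_nonneg] : (1 : ℝ) ≤ 1 + p.Pmax)
          gcongr
      _ = _ := mul_comm _ _
  have hle : rtPower p X ψ S.card ≤ p.Pmax := by
    unfold rtPower
    split_ifs with h
    · exact lambertPower_le p hX hψ
    · rw [Real.le_log_iff_exp_le (by linarith [p.Pmax_nonneg])] at hn_le
      linarith
  refine ⟨hle, ?_⟩
  set P₀ := rtPower p X ψ S.card with hP₀
  set m₀ := rtDur p X ψ S.card with hm₀
  have hP₀pos : 0 < P₀ := rtPower_pos p hn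
  have hy : 0 < Real.log (1 + P₀) := log_rtPower_pos p hn
  have hm₀L : m₀ * Real.log (1 + P₀) = p.L := rtDur_mul_log p hn
  set y := Real.log (1 + P₀) with hydef
  have heq := tangent_eq p hP₀pos.le hm₀L
  rw [← hydef] at heq
  -- Complementary slackness: the slope vanishes, or it is nonnegative and `m₀` is the shortest
  -- possible duration, or it is nonpositive and the durations `m₀` already use the whole slot. The
  -- tangent at rate `y` then bounds the cost of the competitor from below.
  have hslope : 0 ≤ costSlope p X ψ y * (∑ i ∈ S, m i - S.card * m₀) := by
    rcases costSlope_rtPower p hn hX hψ hle with h | ⟨h, h'⟩ | ⟨h, h'⟩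
    · rw [h, zero_mul]
    · refine mul_nonneg h (sub_nonneg.2 ?_)
      calc (S.card : ℝ) * m₀ = ∑ i ∈ S, m₀ := by simp
        _ ≤ ∑ i ∈ S, m i := Finset.sum_le_sum fun i hi => by
            have := hm_ge i hi
            rw [← h', ← hm₀L] at this
            exact le_of_mul_le_mul_right this hy
    · refine mul_nonneg_of_nonpos_of_nonpos h ?_
      have : (S.card : ℝ) * m₀ = p.T := by
        have h0 : (S.card : ℝ) ≠ 0 := by exact_mod_cast hn
        have h1 : y = S.card * p.L / p.T := h'
        rw [h1] at hm₀L
        field_simp at hm₀L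
        rw [mul_comm, hm₀L]
      linarith
  have hXT : 0 ≤ X / p.T := by positivity
  calc S.card * (X * P₀ * m₀ / p.T + ψ * m₀)
      = S.card * (X / p.T * (P₀ * m₀) + ψ * m₀) := by ring
    _ = S.card * (X / p.T * (p.L * Real.exp y)) + costSlope p X ψ y * (S.card * m₀) := by
        rw [← heq, costSlope]; ring
    _ ≤ S.card * (X / p.T * (p.L * Real.exp y)) + costSlope p X ψ y * ∑ i ∈ S, m i := by
        linarith
    _ = ∑ i ∈ S, (X / p.T * (p.L * Real.exp y + m i * (Real.exp y * (1 - y) - 1)) + ψ * m i) := by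
        rw [Finset.mul_sum, ← nsmul_eq_mul, ← Finset.sum_const, ← Finset.sum_add_distrib]
        refine Finset.sum_congr rfl fun i _ => ?_
        rw [costSlope]; ring
    _ ≤ ∑ i ∈ S, (X / p.T * (P i * m i) + ψ * m i) := by
        refine Finset.sum_le_sum fun i hi => ?_
        have := tangent_le p (y := y) (hm i hi) (hP i hi).1 (hmP i hi)
        gcongr
    _ = _ := Finset.sum_congr rfl fun i _ => by ring

/-! ### The power of the NRT users -/

lemma nrtPower_mem (u : State R N) (s : Slot R N) (i : N) :
    nrtPower p u s i ∈ Set.Icc 0 p.Pmax := by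
  have := p.Pmax_nonneg
  unfold nrtPower
  split_ifs
  · exact ⟨le_rfl, this⟩
  · exact ⟨le_rfl, this⟩
  · exact ⟨this, le_rfl⟩
  · exact ⟨le_min (le_max_right _ _) this, min_le_right _ _⟩

/-- Water-filling maximizes `Q log (1 + P) - X P / T`. -/
lemma le_psiNR {u : State R N} {s : Slot R N} {i : N} (hQ : 0 ≤ u.Q i) (hX : 0 ≤ u.X) {P : ℝ}
    (hP : P ∈ Set.Icc 0 p.Pmax) :
    u.Q i * Real.log (1 + P * ind (s.2 (Sum.inr i))) - u.X * P / p.T ≤ psiNR p u s i := by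
  have hT := p.T_pos
  obtain ⟨hP0, hPm⟩ := hP
  unfold psiNR nrtPower
  by_cases hs : s.2 (Sum.inr i) = false
  · have : 0 ≤ u.X * P / p.T := by positivity
    simpa [hs, ind] using this
  · rw [Bool.not_eq_false] at hs
    simp only [hs, ind, if_true, mul_one, Bool.true_eq_false, if_false]
    rcases hX.eq_or_lt with hX | hX
    · simp only [← hX, if_true, zero_mul, zero_div, sub_zero]
      split_ifs with h
      · simp [h]
      · gcongr
    · rw [if_neg hX.ne']
      set P₀ := min (max (p.T * u.Q i / u.X - 1) 0) p.Pmax with hP₀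
      have h0 : 0 ≤ P₀ := le_min (le_max_right _ _) p.Pmax_nonneg
      -- The concave logarithm lies below its tangent at `P₀`. It remains to compare the slope `Q /
      -- (1 + P₀)` with the power price `X / T`.
      have htan : u.Q i * Real.log (1 + P) - u.Q i * Real.log (1 + P₀) ≤
          u.Q i * ((P - P₀) / (1 + P₀)) := by
        rw [← mul_sub, ← Real.log_div (by linarith) (by linarith)]
        gcongr
        refine (Real.log_le_sub_one_of_pos (by positivity)).trans (le_of_eq ?_)
        field_simp
        ring
      have hkey : u.Q i * ((P - P₀) / (1 + P₀)) ≤ u.X / p.T * (P - P₀) := by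
        -- First-order condition on `[0, Pmax]`: the price dominates if `P₀ = 0`, the two agree at
        -- an uncapped `P₀`, and the marginal rate dominates if `P₀ = Pmax`.
        have : 0 ≤ (u.X / p.T - u.Q i / (1 + P₀)) * (P - P₀) := by
          have hiff : u.Q i / (1 + P₀) ≤ u.X / p.T ↔ p.T * u.Q i / u.X - 1 ≤ P₀ := by
            rw [div_le_div_iff₀ (by linarith) hT, sub_le_iff_le_add, div_le_iff₀ hX]
            constructor <;> intro h <;> linarith
          have hiff' : u.X / p.T ≤ u.Q i / (1 + P₀) ↔ P₀ ≤ p.T * u.Q i / u.X - 1 := by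
            rw [div_le_div_iff₀ hT (by linarith), le_sub_iff_add_le, le_div_iff₀ hX]
            constructor <;> intro h <;> linarith
          rcases le_total (p.T * u.Q i / u.X - 1) 0 with hc | hc
          · have hz : P₀ = 0 := by
              rw [hP₀, max_eq_right hc, min_eq_left p.Pmax_nonneg]
            refine mul_nonneg (sub_nonneg.2 (hiff.2 (by linarith))) (by linarith)
          · rw [max_eq_left hc] at hP₀
            rcases le_total (p.T * u.Q i / u.X - 1) p.Pmax with hc' | hc'
            · rw [min_eq_left hc'] at hP₀
              have := le_antisymm (hiff.2 hP₀.ge) (hiff'.2 hP₀.le)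
              rw [this, sub_self, zero_mul]
            · rw [min_eq_right hc'] at hP₀
              exact mul_nonneg_of_nonpos_of_nonpos (sub_nonpos.2 (hiff'.2 (by linarith)))
                (by linarith)
        have e : u.Q i * ((P - P₀) / (1 + P₀)) = u.Q i / (1 + P₀) * (P - P₀) := by ring
        rw [e]
        linarith
      have e1 : u.X * P / p.T = u.X / p.T * P := by ring
      have e2 : u.X * P₀ / p.T = u.X / p.T * P₀ := by ring
      rw [e1, e2]
      linarith

lemma psiNR_nonneg {u : State R N} {s : Slot R N} {i : N} (hQ : 0 ≤ u.Q i) (hX : 0 ≤ u.X) :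
    0 ≤ psiNR p u s i := by
  simpa using le_psiNR p (s := s) hQ hX (P := 0) ⟨le_rfl, p.Pmax_nonneg⟩

/-- At fixed power the return increases with the queue, so among users with channel on the longest
queue wins. A user with channel off can only waste power, and `psiNR` is nonnegative. -/
lemma le_psiNR_of_isLongest {u : State R N} (hu : u.Nonneg) {s : Slot R N} {i₀ : N}
    (hi₀ : IsLongest u s i₀) (i : N) {P : ℝ} (hP : P ∈ Set.Icc 0 p.Pmax) :
    u.Q i * Real.log (1 + P * ind (s.2 (Sum.inr i))) - u.X * P / p.T ≤ psiNR p u s i₀ := by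
  have hT := p.T_pos
  obtain ⟨-, hQ, hX⟩ := hu
  by_cases hs : s.2 (Sum.inr i) = true
  · rcases hi₀ with ⟨h, h'⟩ | h
    · refine le_trans ?_ (le_psiNR p (s := s) (hQ i₀) hX hP)
      have := hP.1
      have hlog : 0 ≤ Real.log (1 + P) := Real.log_nonneg (by linarith)
      simp only [hs, h, ind, if_true, mul_one]
      have := h' i hs
      gcongr
    · simp [h i] at hs
  · have h0 := psiNR_nonneg p (s := s) (hQ i₀) hX
    have := hP.1
    have : 0 ≤ u.X * P / p.T := by positivity
    simp only [ind, hs]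
    simp only [Bool.false_eq_true, if_false, mul_zero, add_zero, Real.log_one]
    linarith

end Powers

/-! ### Sets of users with the largest values -/

/-- Exchange argument: in a subset of `E` of the given size with maximal sum, replacing a member by
a non-member cannot increase the sum. -/
lemma exists_top_set {R : Type*} (E S' : Finset R) (Y : R → ℝ) (hS' : S' ⊆ E) :
    ∃ S ⊆ E, S.card = S'.card ∧ (∀ i ∈ S, ∀ j ∈ E, j ∉ S → Y j ≤ Y i) ∧
      ∑ i ∈ S', Y i ≤ ∑ i ∈ S, Y i := by
  classical
  obtain ⟨S, hS, hmax⟩ := (E.powersetCard S'.card).exists_max_image (fun S => ∑ i ∈ S, Y i)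
    ⟨S', Finset.mem_powersetCard.2 ⟨hS', rfl⟩⟩
  rw [Finset.mem_powersetCard] at hS
  refine ⟨S, hS.1, hS.2, fun i hi j hj hjS => ?_,
    hmax S' (Finset.mem_powersetCard.2 ⟨hS', rfl⟩)⟩
  have hj' : j ∉ S.erase i := fun h => hjS (Finset.mem_of_mem_erase h)
  have h := hmax (insert j (S.erase i)) (Finset.mem_powersetCard.2 ⟨?_, ?_⟩)
  · rw [Finset.sum_insert hj', ← Finset.add_sum_erase S Y hi] at h
    linarith
  · exact Finset.insert_subset hj ((Finset.erase_subset _ _).trans hS.1)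
  · rw [Finset.card_insert_of_notMem hj', Finset.card_erase_add_one hi, hS.2]

/-! ### The algorithm maximizes the gain of each slot -/

section Decision

variable {R N : Type*} [Fintype R] [Fintype N] {p : Params R} {B : ℝ} {u : State R N}
  {s : Slot R N} {d : Action R N}

lemma ind_nonneg (b : Bool) : 0 ≤ ind b := by cases b <;> simp [ind]

lemma ind_le_one (b : Bool) : ind b ≤ 1 := by cases b <;> simp [ind]

open Classical in
/-- Indicator of the event that RT user `i` is scheduled. -/
noncomputable def served (d : Action R N) (i : R) : ℝ := if d.dur (Sum.inl i) ≠ 0 then 1 else 0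

lemma served_mem (d : Action R N) (i : R) : served d i ∈ Set.Icc (0 : ℝ) 1 := by
  unfold served
  split_ifs <;> simp

/-- The part of the one-slot Lyapunov drift, with reversed sign, that depends on the decision,
including the reward `B L` for each admitted packet. -/
noncomputable def gain (p : Params R) (B : ℝ) (u : State R N) (s : Slot R N) (d : Action R N) : ℝ :=
  ∑ i, u.Y i * served d i - u.X * slotPower p d
    + ∑ i, u.Q i * (d.dur (Sum.inr i) * rate s d (Sum.inr i))
    + ∑ i, (B - u.Q i) * (p.L * ind (d.adm i))

lemma rate_nonneg (hd : d.Valid p s) (j : R ⊕ N) : 0 ≤ rate s d j := by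
  have := mul_nonneg (hd.pow_mem j).1 (ind_nonneg (s.2 j))
  exact Real.log_nonneg (by linarith)

lemma rate_le (hd : d.Valid p s) (j : R ⊕ N) : rate s d j ≤ Real.log (1 + p.Pmax) := by
  have h0 := mul_nonneg (hd.pow_mem j).1 (ind_nonneg (s.2 j))
  have h1 : d.pow j * ind (s.2 j) ≤ p.Pmax :=
    (mul_le_of_le_one_right (hd.pow_mem j).1 (ind_le_one _)).trans (hd.pow_mem j).2
  unfold rate
  gcongr

lemma eligible_of_dur_ne_zero (hd : d.Valid p s) {i : R} (hi : d.dur (Sum.inl i) ≠ 0) :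
    s.1 (Sum.inl i) = true ∧ s.2 (Sum.inl i) = true := by
  obtain ⟨h1, h2⟩ := hd.rt i hi
  refine ⟨h1, ?_⟩
  by_contra h
  rw [Bool.not_eq_true] at h
  simp only [rate, h, ind, Bool.false_eq_true, if_false, mul_zero, add_zero, Real.log_one] at h2
  exact p.L_pos.ne h2

lemma rt_bits (hd : d.Valid p s) (i : R) :
    d.dur (Sum.inl i) * rate s d (Sum.inl i) = p.L * served d i := by
  unfold served
  split_ifs with h
  · rw [(hd.rt i h).2, mul_one]
  · rw [not_not] at h
    rw [h, zero_mul, mul_zero]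

/-- Decomposition of the gain into its RT and NRT parts. -/
lemma gain_eq :
    gain p B u s d = ∑ i, (u.Y i * served d i
        - u.X * (d.pow (Sum.inl i) * d.dur (Sum.inl i)) / p.T)
      + ∑ i, d.dur (Sum.inr i) * (u.Q i * rate s d (Sum.inr i) - u.X * d.pow (Sum.inr i) / p.T)
      + ∑ i, (B - u.Q i) * (p.L * ind (d.adm i)) := by
  unfold gain slotPower
  rw [Fintype.sum_sum_type]
  have h : ∀ x y : ℝ, u.X * ((x + y) / p.T) = u.X / p.T * x + u.X / p.T * y := fun x y => by ring
  rw [h, Finset.mul_sum, Finset.mul_sum, Finset.sum_sub_distrib]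
  have e1 : ∑ i, u.X / p.T * (d.pow (Sum.inl i) * d.dur (Sum.inl i)) =
      ∑ i, u.X * (d.pow (Sum.inl i) * d.dur (Sum.inl i)) / p.T :=
    Finset.sum_congr rfl fun i _ => by ring
  have e2 : ∑ i, d.dur (Sum.inr i) * (u.Q i * rate s d (Sum.inr i)
        - u.X * d.pow (Sum.inr i) / p.T) =
      ∑ i, u.Q i * (d.dur (Sum.inr i) * rate s d (Sum.inr i)) -
      ∑ i, u.X / p.T * (d.pow (Sum.inr i) * d.dur (Sum.inr i)) := by
    rw [← Finset.sum_sub_distrib]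
    exact Finset.sum_congr rfl fun i _ => by ring
  rw [e1, e2]
  ring

/-- The largest gain that is possible with valid admissions. -/
noncomputable def admGain (p : Params R) (B : ℝ) (u : State R N) (s : Slot R N) : ℝ :=
  ∑ i, (B - u.Q i) * (p.L * ind (if u.Q i < B then s.1 (Sum.inr i) else false))

/-- The terms separate over users, and admission pays exactly when `Q i < B`. This is the threshold
rule of the algorithm. -/
lemma le_admGain (hd : d.Valid p s) :
    ∑ i, (B - u.Q i) * (p.L * ind (d.adm i)) ≤ admGain p B u s := by
  have hL := p.L_pos
  refine Finset.sum_le_sum fun i _ => ?_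
  split_ifs with h
  · have h1 : ind (d.adm i) ≤ ind (s.1 (Sum.inr i)) := by
      rcases hb : d.adm i with _ | _
      · exact (ind_nonneg _)
      · rw [hd.adm_le i hb]
    have : 0 ≤ B - u.Q i := by linarith
    gcongr
  · have h1 := ind_nonneg (d.adm i)
    simp only [ind, Bool.false_eq_true, if_false, mul_zero]
    exact mul_nonpos_of_nonpos_of_nonneg (by linarith) (mul_nonneg hL.le h1)

/-- Every valid decision is dominated by some candidate set. -/
lemma exists_candidate_ge (hu : u.Nonneg) (hd : d.Valid p s) {i₀ : N} (hi₀ : IsLongest u s i₀) :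
    ∃ S, IsCandidate p u s (psiNR p u s i₀) S ∧
      gain p B u s d ≤ psiAux p u (psiNR p u s i₀) S + admGain p B u s := by
  classical
  set ψ := psiNR p u s i₀ with hψdef
  have hψ : 0 ≤ ψ := psiNR_nonneg p (hu.2.1 i₀) hu.2.2
  set S' : Finset R := Finset.univ.filter fun i => d.dur (Sum.inl i) ≠ 0 with hS'
  have hmem : ∀ i, i ∈ S' ↔ d.dur (Sum.inl i) ≠ 0 := fun i => by simp [hS']
  have hsum : ∑ i ∈ S', d.dur (Sum.inl i) = ∑ i, d.dur (Sum.inl i) := by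
    rw [hS', Finset.sum_filter_ne_zero]
  have htot : ∑ i, d.dur (Sum.inl i) + ∑ i, d.dur (Sum.inr i) = p.T := by
    rw [← hd.sum_dur, Fintype.sum_sum_type]
  have hNR : 0 ≤ ∑ i, d.dur (Sum.inr i) := Finset.sum_nonneg fun i _ => (hd.dur_mem _).1
  obtain ⟨hle, hopt⟩ := rtPower_optimal p hu.2.2 hψ S' (fun i => d.pow (Sum.inl i))
    (fun i => d.dur (Sum.inl i)) (fun i _ => (hd.dur_mem _).1) (fun i _ => hd.pow_mem _)
    (fun i hi => by
      have h := (hd.rt i ((hmem i).1 hi)).2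
      simpa [rate, (eligible_of_dur_ne_zero hd ((hmem i).1 hi)).2, ind] using h)
    (by rw [hsum]; linarith)
  -- The served set `S'` need not be a candidate. Moving to eligible users with the largest `Y`,
  -- equally many, leaves the optimized cost unchanged because it depends only on the cardinality.
  obtain ⟨S, hSE, hcard, htop, hY⟩ := exists_top_set
    (Finset.univ.filter fun i : R => s.1 (Sum.inl i) = true ∧ s.2 (Sum.inl i) = true) S' u.Y
    (fun i hi => by simpa using eligible_of_dur_ne_zero hd ((hmem i).1 hi))
  refine ⟨S, ⟨fun i hi => by simpa using hSE hi, fun i hi j hj h1 h2 =>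
    htop i hi j (by simp [h1, h2]) hj, by rw [hcard]; exact hle⟩, ?_⟩
  have hRT : ∑ i, (u.Y i * served d i - u.X * (d.pow (Sum.inl i) * d.dur (Sum.inl i)) / p.T)
      = ∑ i ∈ S', u.Y i - ∑ i ∈ S', u.X * (d.pow (Sum.inl i) * d.dur (Sum.inl i)) / p.T := by
    rw [← Finset.sum_sub_distrib, hS', Finset.sum_filter]
    refine Finset.sum_congr rfl fun i _ => ?_
    unfold served
    split_ifs with h
    · rw [mul_one]
    · rw [not_not] at h
      simp [h]
  have hN : ∑ i, d.dur (Sum.inr i) * (u.Q i * rate s d (Sum.inr i)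
      - u.X * d.pow (Sum.inr i) / p.T) ≤ ψ * (p.T - ∑ i ∈ S', d.dur (Sum.inl i)) := by
    have hrest : p.T - ∑ i ∈ S', d.dur (Sum.inl i) = ∑ i, d.dur (Sum.inr i) := by
      rw [hsum]; linarith
    rw [hrest, mul_comm, Finset.sum_mul]
    refine Finset.sum_le_sum fun i _ => ?_
    have := le_psiNR_of_isLongest p hu hi₀ i (hd.pow_mem (Sum.inr i))
    exact mul_le_mul_of_nonneg_left this (hd.dur_mem _).1
  have hA := le_admGain (B := B) (u := u) hd
  rw [gain_eq, hRT, psiAux, Finset.sum_sub_distrib, Finset.sum_const, nsmul_eq_mul, hcard]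
  rw [Finset.sum_add_distrib, ← Finset.mul_sum] at hopt
  linarith

/-- The decisions of the algorithm are valid, and they maximize the gain. -/
lemma IsAlgDecision.valid_and_gain_le (hu : u.Nonneg) (h : IsAlgDecision p B u s d) :
    d.Valid p s ∧ ∀ d', d'.Valid p s → gain p B u s d' ≤ gain p B u s d := by
  classical
  obtain ⟨i₀, S, hi₀, hS, hmax, hpR, hdR, hpN, hdN, hadm⟩ := h
  set ψ := psiNR p u s i₀ with hψdef
  have hT := p.T_pos
  have hψ : 0 ≤ ψ := psiNR_nonneg p (hu.2.1 i₀) hu.2.2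
  set P₀ := rtPower p u.X ψ S.card
  set m₀ := rtDur p u.X ψ S.card
  have hm1 : (S.card : ℝ) * m₀ ≤ p.T := card_mul_rtDur_le p u.X ψ S.card
  have hm2 : 0 ≤ (S.card : ℝ) * m₀ := card_mul_rtDur_nonneg p u.X ψ S.card
  have hcard : ∀ i ∈ S, S.card ≠ 0 := fun i hi => Finset.card_ne_zero_of_mem hi
  have hsumR : ∑ i, d.dur (Sum.inl i) = S.card * m₀ := by
    simp [hdR]
  have hserved : ∀ i, served d i = if i ∈ S then 1 else 0 := fun i => by
    unfold served
    rw [hdR]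
    by_cases hi : i ∈ S
    · simp only [hi, if_true]
      rw [if_pos (rtDur_pos p (hcard i hi)).ne']
    · simp [hi]
  have hvalid : d.Valid p s := by
    refine ⟨fun i hi => ?_, fun j => ?_, fun j => ?_, ?_, fun i hi => ?_⟩
    · rw [hadm] at hi
      split_ifs at hi with hQ
      exact hi
    · rcases j with i | i
      · rw [hpR]
        split_ifs with hi
        · exact ⟨(rtPower_pos p (hcard i hi)).le, hS.pow_le⟩
        · exact ⟨le_rfl, p.Pmax_nonneg⟩
      · rw [hpN]
        split_ifs with hi
        · exact nrtPower_mem p u s i₀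
        · exact ⟨le_rfl, p.Pmax_nonneg⟩
    · rcases j with i | i
      · rw [hdR]
        split_ifs with hi
        · have h1 : (1 : ℝ) ≤ S.card := by exact_mod_cast Nat.one_le_iff_ne_zero.2 (hcard i hi)
          have h2 : 0 < m₀ := rtDur_pos p (hcard i hi)
          refine ⟨h2.le, ?_⟩
          nlinarith
        · exact ⟨le_rfl, hT.le⟩
      · rw [hdN]
        split_ifs with hi
        · exact ⟨by linarith, by linarith⟩
        · exact ⟨le_rfl, hT.le⟩
    · rw [Fintype.sum_sum_type, hsumR]
      simp [hdN]
    · rw [hdR] at hi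
      have hiS : i ∈ S := by
        by_contra hn
        simp [hn] at hi
      refine ⟨(hS.eligible i hiS).1, ?_⟩
      rw [rate, hdR, hpR, if_pos hiS, if_pos hiS, (hS.eligible i hiS).2]
      simpa [ind] using rtDur_mul_log p (X := u.X) (ψ := ψ) (hcard i hiS)
  refine ⟨hvalid, fun d' hd' => ?_⟩
  obtain ⟨S', hS', hle⟩ := exists_candidate_ge (B := B) hu hd' hi₀
  -- What remains is that the upper bound is attained: the gain of the algorithm equals the value of
  -- its candidate set plus `admGain`.
  refine hle.trans ((add_le_add_left (hmax S' hS') _).trans (le_of_eq ?_))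
  rw [gain_eq, psiAux, admGain]
  congr 1
  · congr 1
    · rw [← Finset.sum_filter_add_sum_filter_not Finset.univ (fun i => i ∈ S)]
      rw [Finset.filter_mem_eq_inter, Finset.univ_inter]
      rw [Finset.sum_eq_zero (s := Finset.univ.filter fun i => i ∉ S), add_zero]
      · refine Finset.sum_congr rfl fun i hi => ?_
        rw [hserved, hpR, hdR, if_pos hi, if_pos hi, if_pos hi]
        ring
      · intro i hi
        rw [Finset.mem_filter] at hi
        rw [hserved, hpR, hdR, if_neg hi.2, if_neg hi.2, if_neg hi.2]
        simp
    · rw [Finset.sum_eq_single i₀]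
      · rw [hdN, if_pos rfl, rate, hpN, if_pos rfl]
        exact mul_comm _ _
      · intro i _ hi
        rw [hdN, if_neg hi, zero_mul]
      · simp
  · refine Finset.sum_congr rfl fun i _ => ?_
    rw [hadm]

lemma exists_isLongest [Nonempty N] (u : State R N) (s : Slot R N) : ∃ i, IsLongest u s i := by
  classical
  by_cases h : ∃ i : N, s.2 (Sum.inr i) = true
  · obtain ⟨i, hi⟩ := h
    obtain ⟨j, hj, hmax⟩ := (Finset.univ.filter fun i : N => s.2 (Sum.inr i) = true).exists_max_image
      u.Q ⟨i, by simpa using hi⟩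
    refine ⟨j, Or.inl ⟨by simpa using hj, fun k hk => hmax k (by simpa using hk)⟩⟩
  · push Not at h
    exact ⟨Classical.arbitrary N, Or.inr fun j => by simpa using h j⟩

lemma isCandidate_empty {i₀ : N} (hu : u.Nonneg) : IsCandidate p u s (psiNR p u s i₀) ∅ :=
  ⟨by simp, by simp, by
    simpa using rtPower_zero_le p hu.2.2 (psiNR_nonneg p (s := s) (hu.2.1 i₀) hu.2.2)⟩

lemma exists_best_candidate {i₀ : N} (hu : u.Nonneg) :
    ∃ S, IsCandidate p u s (psiNR p u s i₀) S ∧ ∀ S', IsCandidate p u s (psiNR p u s i₀) S' →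
      psiAux p u (psiNR p u s i₀) S' ≤ psiAux p u (psiNR p u s i₀) S := by
  classical
  obtain ⟨S, hS, hmax⟩ := (Finset.univ.filter fun S : Finset R =>
    IsCandidate p u s (psiNR p u s i₀) S).exists_max_image (psiAux p u (psiNR p u s i₀))
    ⟨∅, by simpa using isCandidate_empty hu⟩
  exact ⟨S, by simpa using hS, fun S' hS' => hmax S' (by simpa using hS')⟩

end Decision

/-! ### Measurability -/

section Measurability

variable {R N : Type*} [Fintype R] [Fintype N]

/-- Pulled back from the coordinates, so that measurability of a map into states can be checked
queue by queue. The same is done for actions. -/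
instance : MeasurableSpace (State R N) :=
  MeasurableSpace.comap (fun u => (u.Y, u.Q, u.X)) inferInstance

instance : MeasurableSpace (Action R N) :=
  MeasurableSpace.comap (fun d => (d.dur, d.pow, d.adm)) inferInstance

lemma State.measurable_coords : Measurable fun u : State R N => (u.Y, u.Q, u.X) :=
  comap_measurable _

lemma State.measurable_Y (i : R) : Measurable fun u : State R N => u.Y i :=
  (measurable_pi_apply i).comp State.measurable_coords.fst

lemma State.measurable_Q (i : N) : Measurable fun u : State R N => u.Q i :=
  (measurable_pi_apply i).comp State.measurable_coords.snd.fst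

lemma State.measurable_X : Measurable fun u : State R N => u.X :=
  State.measurable_coords.snd.snd

lemma Action.measurable_coords : Measurable fun d : Action R N => (d.dur, d.pow, d.adm) :=
  comap_measurable _

lemma Action.measurable_dur (j : R ⊕ N) : Measurable fun d : Action R N => d.dur j :=
  (measurable_pi_apply j).comp Action.measurable_coords.fst

lemma Action.measurable_pow (j : R ⊕ N) : Measurable fun d : Action R N => d.pow j :=
  (measurable_pi_apply j).comp Action.measurable_coords.snd.fst

lemma Action.measurable_adm (i : N) : Measurable fun d : Action R N => d.adm i :=
  (measurable_pi_apply i).comp Action.measurable_coords.snd.snd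

variable {α : Type*} [MeasurableSpace α]

lemma State.measurable_of {f : α → State R N} (hY : ∀ i, Measurable fun x => (f x).Y i)
    (hQ : ∀ i, Measurable fun x => (f x).Q i) (hX : Measurable fun x => (f x).X) :
    Measurable f :=
  measurable_comap_iff.2 ((measurable_pi_lambda _ hY).prodMk ((measurable_pi_lambda _ hQ).prodMk hX))

lemma Action.measurable_of {f : α → Action R N} (hd : ∀ j, Measurable fun x => (f x).dur j)
    (hp : ∀ j, Measurable fun x => (f x).pow j) (ha : ∀ i, Measurable fun x => (f x).adm i) :
    Measurable f :=
  measurable_comap_iff.2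
    ((measurable_pi_lambda _ hd).prodMk ((measurable_pi_lambda _ hp).prodMk
      (measurable_pi_lambda _ ha)))

lemma measurable_ind {f : α → Bool} (hf : Measurable f) : Measurable fun x => ind (f x) :=
  (Measurable.of_discrete (f := ind)).comp hf

variable {u : α → State R N} {s : α → Slot R N} {d : α → Action R N}

lemma measurable_rate (hs : Measurable s) (hd : Measurable d) (j : R ⊕ N) :
    Measurable fun x => rate (s x) (d x) j := by
  have h1 := (Action.measurable_pow j).comp hd
  have h2 := measurable_ind ((measurable_pi_apply j).comp hs.snd)
  exact Real.measurable_log.comp (measurable_const.add (h1.mul h2))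

lemma measurable_slotPower (p : Params R) (hd : Measurable d) :
    Measurable fun x => slotPower p (d x) := by
  refine Measurable.div_const (Finset.measurable_sum _ fun j _ => ?_) _
  exact ((Action.measurable_pow j).comp hd).mul ((Action.measurable_dur j).comp hd)

lemma measurable_served (hd : Measurable d) (i : R) : Measurable fun x => served (d x) i := by
  classical
  have h := (Action.measurable_dur (Sum.inl i)).comp hd
  unfold served
  exact Measurable.ite ((measurableSet_eq_fun h measurable_const).compl)
    measurable_const measurable_const

lemma measurable_nrtBits (hs : Measurable s) (hd : Measurable d) (i : N) :
    Measurable fun x => (d x).dur (Sum.inr i) * rate (s x) (d x) (Sum.inr i) :=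
  ((Action.measurable_dur _).comp hd).mul (measurable_rate hs hd _)

lemma measurable_arrival (hs : Measurable s) (j : R ⊕ N) :
    Measurable fun x => ind ((s x).1 j) :=
  measurable_ind ((measurable_pi_apply j).comp hs.fst)

lemma measurable_admInd (hd : Measurable d) (i : N) : Measurable fun x => ind ((d x).adm i) :=
  measurable_ind ((Action.measurable_adm i).comp hd)

lemma measurable_step (p : Params R) (hu : Measurable u) (hs : Measurable s) (hd : Measurable d) :
    Measurable fun x => step p (u x) (s x) (d x) := by
  refine State.measurable_of (fun i => ?_) (fun i => ?_) ?_
  · exact Measurable.max (((State.measurable_Y i).comp hu |>.add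
      ((measurable_arrival hs _).mul_const _)).sub (measurable_served hd i)) measurable_const
  · exact Measurable.max (((State.measurable_Q i).comp hu |>.add
      ((measurable_admInd hd i).const_mul _)).sub (measurable_nrtBits hs hd i)) measurable_const
  · exact Measurable.max (((State.measurable_X).comp hu |>.add
      (measurable_slotPower p hd)).sub measurable_const) measurable_const

/-! ### Measurability of the decisions of the algorithm -/

lemma strictMonoOn_mul_exp : StrictMonoOn (fun w : ℝ => w * Real.exp w) (Set.Ici (-1)) := by
  refine strictMonoOn_of_deriv_pos (convex_Ici _) (by fun_prop) fun w hw => ?_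
  rw [interior_Ici, Set.mem_Ioi] at hw
  have h : HasDerivAt (fun w : ℝ => w * Real.exp w) (1 * Real.exp w + w * Real.exp w) w :=
    (hasDerivAt_id w).mul (Real.hasDerivAt_exp w)
  rw [h.deriv, ← add_mul]
  exact mul_pos (by linarith) (Real.exp_pos w)

lemma lambertW0_spec' {z : ℝ} (hz : -Real.exp (-1) ≤ z) :
    -1 ≤ lambertW0 z ∧ lambertW0 z * Real.exp (lambertW0 z) = z := by
  have h1 : -1 ≤ z * Real.exp 1 := by
    have := mul_le_mul_of_nonneg_right hz (Real.exp_pos 1).le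
    rwa [neg_mul, ← Real.exp_add, neg_add_cancel, Real.exp_zero] at this
  have h2 : z * Real.exp 1 / Real.exp 1 = z := by
    field_simp
  have := lambertW0_spec h1
  rwa [h2] at this

/-- On `[-1/e, ∞)` it is monotone, as the inverse of a strictly increasing function. Below that
interval there is no preimage and `Function.invFunOn` returns one fixed default value. Truncating
the argument at `-1/e` makes the first piece monotone on the whole line. -/
lemma measurable_lambertW0 : Measurable lambertW0 := by
  classical
  set c : ℝ := -Real.exp (-1) with hc
  have hmono : Monotone fun z => lambertW0 (max z c) := by
    intro a b hab
    obtain ⟨ha1, ha2⟩ := lambertW0_spec' (le_max_right a c)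
    obtain ⟨hb1, hb2⟩ := lambertW0_spec' (le_max_right b c)
    refine (strictMonoOn_mul_exp.le_iff_le ha1 hb1).1 ?_
    rw [ha2, hb2]
    exact max_le_max_right c hab
  have hpiece : lambertW0 = fun z => if c ≤ z then lambertW0 (max z c)
      else Classical.choice inferInstance := by
    funext z
    split_ifs with h
    · rw [max_eq_left h]
    · unfold lambertW0
      rw [Function.invFunOn_neg]
      rintro ⟨w, hw, rfl⟩
      apply h
      have := strictMonoOn_mul_exp.monotoneOn (Set.mem_Ici.2 le_rfl) hw hw
      simpa [hc] using this
  rw [hpiece]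
  exact Measurable.ite measurableSet_Ici hmono.measurable measurable_const

lemma measurable_lambertPower (p : Params R) {X ψ : α → ℝ} (hX : Measurable X)
    (hψ : Measurable ψ) : Measurable fun x => lambertPower p (X x) (ψ x) := by
  have hz : Measurable fun x => p.T * ψ x / X x - 1 := by fun_prop
  unfold lambertPower
  refine Measurable.ite (measurableSet_eq_fun hX measurable_const)
    (Measurable.ite (measurableSet_eq_fun hψ measurable_const) measurable_const measurable_const)
    (Measurable.min (Measurable.sub_const (Measurable.ite
      (measurableSet_eq_fun hz measurable_const) measurable_const ?_) _) measurable_const)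
  exact hz.div (measurable_lambertW0.comp (hz.div_const _))

lemma measurable_rtPower (p : Params R) {X ψ : α → ℝ} (hX : Measurable X)
    (hψ : Measurable ψ) (n : ℕ) : Measurable fun x => rtPower p (X x) (ψ x) n := by
  have hl := measurable_lambertPower p hX hψ
  unfold rtPower
  refine Measurable.ite (MeasurableSet.inter ?_ ?_) hl measurable_const
  · exact measurableSet_lt measurable_const hl
  · have h : Measurable fun x => n * (p.L / Real.log (1 + lambertPower p (X x) (ψ x))) := by
      fun_prop
    exact measurableSet_le h measurable_const

lemma measurable_rtDur (p : Params R) {X ψ : α → ℝ} (hX : Measurable X)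
    (hψ : Measurable ψ) (n : ℕ) : Measurable fun x => rtDur p (X x) (ψ x) n := by
  have := measurable_rtPower p hX hψ n
  unfold rtDur
  fun_prop

lemma measurable_nrtPower (p : Params R) (s : Slot R N) (i : N) :
    Measurable fun u : State R N => nrtPower p u s i := by
  have hX := State.measurable_X (R := R) (N := N)
  have hQ := State.measurable_Q (R := R) i
  unfold nrtPower
  refine Measurable.ite (MeasurableSet.const _) measurable_const (Measurable.ite
    (measurableSet_eq_fun hX measurable_const) (Measurable.ite
      (measurableSet_eq_fun hQ measurable_const) measurable_const measurable_const) ?_)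
  fun_prop

lemma measurable_psiNR (p : Params R) (s : Slot R N) (i : N) :
    Measurable fun u : State R N => psiNR p u s i := by
  have hX := State.measurable_X (R := R) (N := N)
  have hQ := State.measurable_Q (R := R) i
  have hP := measurable_nrtPower p s i
  unfold psiNR
  fun_prop

lemma measurable_psiAux (p : Params R) {ψ : State R N → ℝ} (hψ : Measurable ψ) (S : Finset R) :
    Measurable fun u : State R N => psiAux p u (ψ u) S := by
  have hX := State.measurable_X (R := R) (N := N)
  have hP := measurable_rtPower p hX hψ S.card
  have hD := measurable_rtDur p hX hψ S.card
  have hY := State.measurable_Y (R := R) (N := N)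
  unfold psiAux
  fun_prop

lemma measurableSet_isLongest (s : Slot R N) (i : N) :
    MeasurableSet {u : State R N | IsLongest u s i} := by
  have hQ := State.measurable_Q (R := R) (N := N)
  have hset : {u : State R N | IsLongest u s i} =
      ({_u | s.2 (Sum.inr i) = true} ∩ ⋂ j, {u | s.2 (Sum.inr j) = true → u.Q j ≤ u.Q i}) ∪
      {_u | ∀ j : N, s.2 (Sum.inr j) = false} := by
    ext u
    simp [IsLongest]
  rw [hset]
  refine ((MeasurableSet.const _).inter (MeasurableSet.iInter fun j => ?_)).union
    (MeasurableSet.const _)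
  by_cases h : s.2 (Sum.inr j) = true
  · simpa [h] using measurableSet_le (hQ j) (hQ i)
  · simp [h]

lemma measurableSet_isCandidate (p : Params R) {ψ : State R N → ℝ} (hψ : Measurable ψ)
    (s : Slot R N) (S : Finset R) : MeasurableSet {u : State R N | IsCandidate p u s (ψ u) S} := by
  have hX := State.measurable_X (R := R) (N := N)
  have hY := State.measurable_Y (R := R) (N := N)
  have hP := measurable_rtPower p hX hψ S.card
  have hset : {u : State R N | IsCandidate p u s (ψ u) S} =
      {_u | ∀ i ∈ S, s.1 (Sum.inl i) = true ∧ s.2 (Sum.inl i) = true} ∩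
      ((⋂ i, ⋂ j, {u | (i ∈ S ∧ j ∉ S ∧ s.1 (Sum.inl j) = true ∧ s.2 (Sum.inl j) = true) →
        u.Y j ≤ u.Y i}) ∩ {u | rtPower p u.X (ψ u) S.card ≤ p.Pmax}) := by
    ext u
    simp only [Set.mem_inter_iff, Set.mem_ofPred_eq, Set.mem_iInter]
    exact ⟨fun h => ⟨h.eligible, fun i j hj => h.largest i hj.1 j hj.2.1 hj.2.2.1 hj.2.2.2,
      h.pow_le⟩, fun h => ⟨h.1, fun i hi j hj h1 h2 => h.2.1 i j ⟨hi, hj, h1, h2⟩, h.2.2⟩⟩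
  rw [hset]
  refine (MeasurableSet.const _).inter ((MeasurableSet.iInter fun i => MeasurableSet.iInter
    fun j => ?_).inter (measurableSet_le hP measurable_const))
  by_cases h : i ∈ S ∧ j ∉ S ∧ s.1 (Sum.inl j) = true ∧ s.2 (Sum.inl j) = true
  · simpa only [h, true_imp_iff, not_false_eq_true, and_self] using measurableSet_le (hY j) (hY i)
  · simp only [h, false_imp_iff, Set.ofPred_true, MeasurableSet.univ]

/-- The pair of an NRT user and a set of RT users that the algorithm may choose. -/
def IsChoice (p : Params R) (u : State R N) (s : Slot R N) (c : N × Finset R) : Prop :=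
  IsLongest u s c.1 ∧ IsCandidate p u s (psiNR p u s c.1) c.2 ∧
    ∀ S', IsCandidate p u s (psiNR p u s c.1) S' →
      psiAux p u (psiNR p u s c.1) S' ≤ psiAux p u (psiNR p u s c.1) c.2

lemma measurableSet_isChoice (p : Params R) (s : Slot R N) (c : N × Finset R) :
    MeasurableSet {u : State R N | IsChoice p u s c} := by
  have hψ := measurable_psiNR p s c.1
  have hset : {u : State R N | IsChoice p u s c} = {u | IsLongest u s c.1} ∩
      ({u | IsCandidate p u s (psiNR p u s c.1) c.2} ∩
      ⋂ S', ({u | IsCandidate p u s (psiNR p u s c.1) S'}ᶜ ∪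
        {u | psiAux p u (psiNR p u s c.1) S' ≤ psiAux p u (psiNR p u s c.1) c.2})) := by
    ext u
    simp [IsChoice, imp_iff_not_or]
  rw [hset]
  exact (measurableSet_isLongest s c.1).inter ((measurableSet_isCandidate p hψ s c.2).inter
    (MeasurableSet.iInter fun S' => (measurableSet_isCandidate p hψ s S').compl.union
      (measurableSet_le (measurable_psiAux p hψ S') (measurable_psiAux p hψ c.2))))

/-- Ties are broken by a fixed order on the finitely many indices: each inserted index takes
precedence wherever its set contains the point. -/
lemma exists_measurable_selection {ι : Type*} [Fintype ι] [Nonempty ι] [MeasurableSpace ι]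
    (A : ι → Set α) (hA : ∀ i, MeasurableSet (A i)) :
    ∃ g : α → ι, Measurable g ∧ ∀ x, (∃ i, x ∈ A i) → x ∈ A (g x) := by
  classical
  suffices h : ∀ F : Finset ι, ∃ g : α → ι, Measurable g ∧ ∀ x, (∃ i ∈ F, x ∈ A i) → x ∈ A (g x) by
    obtain ⟨g, hg, hg'⟩ := h Finset.univ
    exact ⟨g, hg, fun x ⟨i, hi⟩ => hg' x ⟨i, Finset.mem_univ i, hi⟩⟩
  intro F
  induction F using Finset.induction_on with
  | empty => exact ⟨fun _ => Classical.arbitrary ι, measurable_const, by simp⟩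
  | insert a F _ ih =>
    obtain ⟨g, hg, hg'⟩ := ih
    refine ⟨(A a).piecewise (fun _ => a) g, Measurable.piecewise (hA a) measurable_const hg, ?_⟩
    rintro x ⟨i, hi, hx⟩
    by_cases hxa : x ∈ A a
    · simp [Set.piecewise, hxa]
    · simp only [Set.piecewise, hxa, if_false]
      rcases Finset.mem_insert.1 hi with rfl | hi
      · exact absurd hx hxa
      · exact hg' x ⟨i, hi, hx⟩

open Classical in
/-- The decision that belongs to the choice of an NRT user and a set of RT users. -/
noncomputable def choiceAction (p : Params R) (B : ℝ) (u : State R N) (s : Slot R N)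
    (c : N × Finset R) : Action R N where
  dur := Sum.elim
    (fun i => if i ∈ c.2 then rtDur p u.X (psiNR p u s c.1) c.2.card else 0)
    (fun i => if i = c.1 then p.T - c.2.card * rtDur p u.X (psiNR p u s c.1) c.2.card else 0)
  pow := Sum.elim
    (fun i => if i ∈ c.2 then rtPower p u.X (psiNR p u s c.1) c.2.card else 0)
    (fun i => if i = c.1 then nrtPower p u s c.1 else 0)
  adm := fun i => if u.Q i < B then s.1 (Sum.inr i) else false

lemma isAlgDecision_choiceAction {p : Params R} {B : ℝ} {u : State R N} {s : Slot R N}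
    {c : N × Finset R} (h : IsChoice p u s c) :
    IsAlgDecision p B u s (choiceAction p B u s c) :=
  ⟨c.1, c.2, h.1, h.2.1, h.2.2, fun _ => rfl, fun _ => rfl, fun _ => rfl, fun _ => rfl,
    fun _ => rfl⟩

lemma measurable_choiceAction (p : Params R) (B : ℝ) (s : Slot R N) (c : N × Finset R) :
    Measurable fun u => choiceAction p B u s c := by
  classical
  have hX := State.measurable_X (R := R) (N := N)
  have hQ := State.measurable_Q (R := R) (N := N)
  have hψ := measurable_psiNR p s c.1
  have hP := measurable_rtPower p hX hψ c.2.card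
  have hD := measurable_rtDur p hX hψ c.2.card
  have hN := measurable_nrtPower p s c.1
  refine Action.measurable_of (fun j => ?_) (fun j => ?_) (fun i => ?_)
  · rcases j with i | i
    · exact Measurable.ite (MeasurableSet.const _) hD measurable_const
    · exact Measurable.ite (MeasurableSet.const _) (by fun_prop) measurable_const
  · rcases j with i | i
    · exact Measurable.ite (MeasurableSet.const _) hP measurable_const
    · exact Measurable.ite (MeasurableSet.const _) hN measurable_const
  · exact Measurable.ite (measurableSet_lt (hQ i) measurable_const) measurable_const
      measurable_const

/-- A measurable version of the decision rule of the algorithm. -/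
lemma exists_measurable_decision [Nonempty N] (p : Params R) (B : ℝ) :
    ∃ D : State R N × Slot R N → Action R N, Measurable D ∧
      ∀ u s, u.Nonneg → IsAlgDecision p B u s (D (u, s)) := by
  classical
  let _ : MeasurableSpace (N × Finset R) := ⊤
  choose g hg hg' using fun s : Slot R N => exists_measurable_selection
    (fun c => {u : State R N | IsChoice p u s c}) (measurableSet_isChoice p s)
  refine ⟨fun x => choiceAction p B x.1 x.2 (g x.2 x.1), ?_, fun u s hu => ?_⟩
  -- There are finitely many observations and finitely many choices, so joint measurability reduces
  -- to measurability in the state with both fixed.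
  · refine measurable_from_prod_countable_left fun s => ?_
    have h : Measurable fun x : (N × Finset R) × State R N => choiceAction p B x.2 s x.1 :=
      measurable_from_prod_countable_right fun c => measurable_choiceAction p B s c
    exact h.comp ((hg s).prodMk measurable_id)
  · obtain ⟨i₀, hi₀⟩ := exists_isLongest u s
    obtain ⟨S, hS, hmax⟩ := exists_best_candidate (p := p) (s := s) (i₀ := i₀) hu
    exact isAlgDecision_choiceAction (hg' s u ⟨(i₀, S), hi₀, hS, hmax⟩)

/-! ### Trajectories -/

lemma step_nonneg (p : Params R) (u : State R N) (s : Slot R N) (d : Action R N) :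
    (step p u s d).Nonneg :=
  ⟨fun _ => le_max_right _ _, fun _ => le_max_right _ _, le_max_right _ _⟩

variable {Ω : Type*}

lemma queues_nonneg (p : Params R) {u₀ : State R N} (hu₀ : u₀.Nonneg) (obs : ℕ → Ω → Slot R N)
    (π : ℕ → Ω → Action R N) (k : ℕ) (ω : Ω) : (queues p u₀ obs π k ω).Nonneg := by
  cases k with
  | zero => exact hu₀
  | succ k => exact step_nonneg _ _ _ _

lemma IsPolicy.measurable [mΩ : MeasurableSpace Ω] {ℱ : Filtration ℕ mΩ}
    {π : ℕ → Ω → Action R N} (hπ : IsPolicy ℱ π) (k : ℕ) : Measurable[ℱ k] (π k) :=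
  @Action.measurable_of _ _ _ _ _ (ℱ k) _ (hπ.dur k) (hπ.pow k) (hπ.adm k)

/-- The queues at the beginning of slot `k + 1` are determined by the information of slot `k`. -/
lemma measurable_queues_succ [mΩ : MeasurableSpace Ω] {ℱ : Filtration ℕ mΩ} (p : Params R)
    (u₀ : State R N) {obs : ℕ → Ω → Slot R N} (hobs : ∀ k, Measurable[ℱ k] (obs k))
    {π : ℕ → Ω → Action R N} (hπ : IsPolicy ℱ π) (k : ℕ) :
    Measurable[ℱ k] (queues p u₀ obs π (k + 1)) := by
  induction k with
  | zero =>
    exact @measurable_step _ _ _ _ _ (ℱ 0) _ _ _ p (@measurable_const _ _ _ (ℱ 0) u₀) (hobs 0)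
      (hπ.measurable 0)
  | succ k ih =>
    exact @measurable_step _ _ _ _ _ (ℱ (k + 1)) _ _ _ p (ih.mono (ℱ.mono k.le_succ) le_rfl)
      (hobs (k + 1)) (hπ.measurable (k + 1))

/-- The queues under a decision rule. -/
noncomputable def ruleQueues (p : Params R) (u₀ : State R N) (obs : ℕ → Ω → Slot R N)
    (D : State R N × Slot R N → Action R N) : ℕ → Ω → State R N
  | 0, _ => u₀
  | k + 1, ω => step p (ruleQueues p u₀ obs D k ω) (obs k ω)
      (D (ruleQueues p u₀ obs D k ω, obs k ω))

/-- `queues` takes the whole decision process as given, whereas a feedback rule needs the queues in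
order to decide. Building the closed loop first by recursion removes this circularity. -/
lemma queues_rule (p : Params R) (u₀ : State R N) (obs : ℕ → Ω → Slot R N)
    (D : State R N × Slot R N → Action R N) (k : ℕ) (ω : Ω) :
    queues p u₀ obs (fun k ω => D (ruleQueues p u₀ obs D k ω, obs k ω)) k ω =
      ruleQueues p u₀ obs D k ω := by
  induction k with
  | zero => rfl
  | succ k ih => simp only [queues, ruleQueues, ih]

lemma measurable_ruleQueues [mΩ : MeasurableSpace Ω] {ℱ : Filtration ℕ mΩ} (p : Params R)
    (u₀ : State R N) {obs : ℕ → Ω → Slot R N} (hobs : ∀ k, Measurable[ℱ k] (obs k))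
    {D : State R N × Slot R N → Action R N} (hD : Measurable D) (k : ℕ) :
    Measurable[ℱ k] (ruleQueues p u₀ obs D k) := by
  induction k with
  | zero => exact @measurable_const _ _ _ (ℱ 0) u₀
  | succ k ih =>
    exact (@measurable_step _ _ _ _ _ (ℱ k) _ _ _ p ih (hobs k)
      (hD.comp (ih.prodMk (hobs k)))).mono (ℱ.mono k.le_succ) le_rfl

theorem exists_isAlgorithm [Nonempty N] [mΩ : MeasurableSpace Ω] (ℱ : Filtration ℕ mΩ)
    (p : Params R) (B : ℝ) {u₀ : State R N} (hu₀ : u₀.Nonneg) {obs : ℕ → Ω → Slot R N}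
    (hobs : ∀ k, Measurable[ℱ k] (obs k)) : ∃ π, IsAlgorithm ℱ p B u₀ obs π := by
  obtain ⟨D, hD, hdec⟩ := exists_measurable_decision (R := R) (N := N) p B
  have hmeas : ∀ k, Measurable[ℱ k] fun ω => D (ruleQueues p u₀ obs D k ω, obs k ω) :=
    fun k => hD.comp ((measurable_ruleQueues p u₀ hobs hD k).prodMk (hobs k))
  refine ⟨fun k ω => D (ruleQueues p u₀ obs D k ω, obs k ω),
    ⟨fun k j => (Action.measurable_dur j).comp (hmeas k),
      fun k j => (Action.measurable_pow j).comp (hmeas k),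
      fun k i => (Action.measurable_adm i).comp (hmeas k)⟩, fun k ω => ?_⟩
  rw [queues_rule]
  refine hdec _ _ ?_
  rw [← queues_rule]
  exact queues_nonneg p hu₀ _ _ k ω

end Measurability

/-! ### Lyapunov drift -/

section Drift

variable {R N : Type*} [Fintype R] [Fintype N]

/-- All queues as one vector. -/
def levels (u : State R N) : (R ⊕ N) ⊕ Unit → ℝ
  | Sum.inl (Sum.inl i) => u.Y i
  | Sum.inl (Sum.inr i) => u.Q i
  | Sum.inr _ => u.X

/-- Service minus arrivals of all queues in one slot. -/
noncomputable def surplus (p : Params R) (s : Slot R N) (d : Action R N) : (R ⊕ N) ⊕ Unit → ℝ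
  | Sum.inl (Sum.inl i) => served d i - ind (s.1 (Sum.inl i)) * p.q i
  | Sum.inl (Sum.inr i) =>
      d.dur (Sum.inr i) * rate s d (Sum.inr i) - p.L * ind (d.adm i)
  | Sum.inr _ => p.Pavg - slotPower p d

/-- Number of packets admitted in a slot. -/
noncomputable def admitted (d : Action R N) : ℝ := ∑ i, ind (d.adm i)

/-- Quadratic Lyapunov function. -/
noncomputable def lyapunov (u : State R N) : ℝ := (∑ c, levels u c ^ 2) / 2

variable {p : Params R} {u : State R N} {s : Slot R N} {d : Action R N}

lemma levels_nonneg (hu : u.Nonneg) (c) : 0 ≤ levels u c := by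
  rcases c with (i | i) | _
  exacts [hu.1 i, hu.2.1 i, hu.2.2]

lemma levels_step (c) : levels (step p u s d) c = max (levels u c - surplus p s d c) 0 := by
  rcases c with (i | i) | _
  · change max _ _ = max (u.Y i - (served d i - ind (s.1 (Sum.inl i)) * p.q i)) 0
    rw [sub_sub_eq_add_sub]
    rfl
  · change max _ _ = max (u.Q i - (d.dur (Sum.inr i) * rate s d (Sum.inr i)
      - p.L * ind (d.adm i))) 0
    rw [sub_sub_eq_add_sub]
  · change max _ _ = max (u.X - (p.Pavg - slotPower p d)) 0
    rw [sub_sub_eq_add_sub]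

lemma slotPower_mem (hd : d.Valid p s) : slotPower p d ∈ Set.Icc 0 p.Pmax := by
  have hT := p.T_pos
  refine ⟨div_nonneg (Finset.sum_nonneg fun j _ =>
    mul_nonneg (hd.pow_mem j).1 (hd.dur_mem j).1) hT.le, ?_⟩
  unfold slotPower
  rw [div_le_iff₀ hT, ← hd.sum_dur, Finset.mul_sum]
  exact Finset.sum_le_sum fun j _ =>
    mul_le_mul_of_nonneg_right (hd.pow_mem j).2 (hd.dur_mem j).1

lemma nrtBits_mem (hd : d.Valid p s) (j : R ⊕ N) :
    d.dur j * rate s d j ∈ Set.Icc 0 (p.T * Real.log (1 + p.Pmax)) :=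
  ⟨mul_nonneg (hd.dur_mem _).1 (rate_nonneg hd _),
    mul_le_mul (hd.dur_mem _).2 (rate_le hd _) (rate_nonneg hd _) p.T_pos.le⟩

lemma sub_sq_le {x y a b : ℝ} (hx : x ∈ Set.Icc 0 a) (hy : y ∈ Set.Icc 0 b) :
    (x - y) ^ 2 ≤ a ^ 2 + b ^ 2 := by
  have h1 : x ^ 2 ≤ a ^ 2 := pow_le_pow_left₀ hx.1 hx.2 2
  have h2 : y ^ 2 ≤ b ^ 2 := pow_le_pow_left₀ hy.1 hy.2 2
  nlinarith [mul_nonneg hx.1 hy.1]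

/-- Service and arrivals are both nonnegative, so the cross term of the squared difference can be
dropped. What remains are the squared maximal services and arrivals of all queues, whose sum is
twice `C1`. -/
lemma sum_surplus_sq_le (hd : d.Valid p s) : ∑ c, surplus p s d c ^ 2 ≤ 2 * C1 p N := by
  have hR : ∀ i, surplus p s d (Sum.inl (Sum.inl i)) ^ 2 ≤ p.q i ^ 2 + 1 := fun i => by
    have := sub_sq_le (served_mem d i) (y := ind (s.1 (Sum.inl i)) * p.q i) (b := p.q i)
      ⟨mul_nonneg (ind_nonneg _) (p.q_nonneg i),
        mul_le_of_le_one_left (p.q_nonneg i) (ind_le_one _)⟩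
    change (served d i - ind (s.1 (Sum.inl i)) * p.q i) ^ 2 ≤ _
    linarith
  have hN : ∀ i, surplus p s d (Sum.inl (Sum.inr i)) ^ 2 ≤
      p.L ^ 2 + p.T ^ 2 * Real.log (1 + p.Pmax) ^ 2 := fun i => by
    have := sub_sq_le (nrtBits_mem hd (Sum.inr i)) (y := p.L * ind (d.adm i)) (b := p.L)
      ⟨mul_nonneg p.L_pos.le (ind_nonneg _), mul_le_of_le_one_right p.L_pos.le (ind_le_one _)⟩
    rw [mul_pow] at this
    change (d.dur (Sum.inr i) * rate s d (Sum.inr i) - p.L * ind (d.adm i)) ^ 2 ≤ _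
    linarith
  have hX : surplus p s d (Sum.inr ()) ^ 2 ≤ p.Pmax ^ 2 + p.Pavg ^ 2 := by
    have := sub_sq_le (x := p.Pavg) (a := p.Pavg) ⟨p.Pavg_nonneg, le_rfl⟩ (slotPower_mem hd)
    change (p.Pavg - slotPower p d) ^ 2 ≤ _
    linarith
  rw [Fintype.sum_sum_type, Fintype.sum_sum_type]
  have h1 := Finset.sum_le_sum fun i (_ : i ∈ Finset.univ) => hR i
  have h2 := Finset.sum_le_sum fun i (_ : i ∈ Finset.univ) => hN i
  rw [Finset.sum_const, nsmul_eq_mul, Finset.card_univ] at h2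
  simp only [Finset.univ_unique, PUnit.default_eq_unit, Finset.sum_singleton]
  unfold C1
  linarith

lemma abs_surplus_le (hd : d.Valid p s) (c) : |surplus p s d c| ≤ √(2 * C1 p N) := by
  refine Real.abs_le_sqrt (le_trans ?_ (sum_surplus_sq_le hd))
  exact Finset.single_le_sum (f := fun c => surplus p s d c ^ 2) (fun c _ => sq_nonneg _)
    (Finset.mem_univ c)

lemma admitted_mem (d : Action R N) : admitted d ∈ Set.Icc (0 : ℝ) (Fintype.card N) := by
  refine ⟨Finset.sum_nonneg fun i _ => ind_nonneg _, ?_⟩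
  calc admitted d ≤ ∑ _i : N, (1 : ℝ) := Finset.sum_le_sum fun i _ => ind_le_one _
    _ = _ := by simp

/-- Taking the positive part does not increase the square. Expanding the square, the quadratic terms
are absorbed by `C1`. -/
lemma lyapunov_step_le (hd : d.Valid p s) :
    lyapunov (step p u s d) ≤
      lyapunov u + C1 p N - ∑ c, levels u c * surplus p s d c := by
  have h : ∀ c, levels (step p u s d) c ^ 2 ≤
      levels u c ^ 2 - 2 * (levels u c * surplus p s d c) + surplus p s d c ^ 2 := fun c => by
    rw [levels_step]
    have : max (levels u c - surplus p s d c) 0 ^ 2 ≤ (levels u c - surplus p s d c) ^ 2 := by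
      rcases le_total (levels u c - surplus p s d c) 0 with h | h
      · rw [max_eq_right h]
        nlinarith
      · rw [max_eq_left h]
    linarith [this, sub_sq (levels u c) (surplus p s d c)]
  have h' := Finset.sum_le_sum fun c (_ : c ∈ Finset.univ) => h c
  rw [Finset.sum_add_distrib, Finset.sum_sub_distrib, ← Finset.mul_sum] at h'
  have := sum_surplus_sq_le hd
  unfold lyapunov
  linarith

/-- The drift bound is the gain, up to terms that the decision does not influence. -/
lemma sum_levels_surplus (B : ℝ) :
    ∑ c, levels u c * surplus p s d c + B * p.L * admitted d =
      gain p B u s d + (u.X * p.Pavg - ∑ i, u.Y i * (ind (s.1 (Sum.inl i)) * p.q i)) := by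
  rw [Fintype.sum_sum_type, Fintype.sum_sum_type]
  simp only [Finset.univ_unique, PUnit.default_eq_unit, Finset.sum_singleton, levels, surplus,
    gain, admitted, mul_sub, sub_mul, Finset.sum_sub_distrib, Finset.mul_sum]
  have : ∑ i, B * p.L * ind (d.adm i) = ∑ i, B * (p.L * ind (d.adm i)) :=
    Finset.sum_congr rfl fun i _ => by ring
  rw [this]
  ring

/-- Among all valid decisions the algorithm has the best drift-plus-penalty bound. -/
lemma IsAlgDecision.sum_levels_surplus_ge {B : ℝ} (hu : u.Nonneg) (h : IsAlgDecision p B u s d)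
    {d' : Action R N} (hd' : d'.Valid p s) :
    ∑ c, levels u c * surplus p s d' c + B * p.L * admitted d' ≤
      ∑ c, levels u c * surplus p s d c + B * p.L * admitted d := by
  rw [sum_levels_surplus, sum_levels_surplus]
  linarith [(h.valid_and_gain_le hu).2 d' hd']

lemma measurable_levels (c) : Measurable fun u : State R N => levels u c := by
  rcases c with (i | i) | _
  exacts [State.measurable_Y i, State.measurable_Q i, State.measurable_X]

variable {α : Type*} [MeasurableSpace α]

lemma measurable_surplus (p : Params R) {s : α → Slot R N} {d : α → Action R N}
    (hs : Measurable s) (hd : Measurable d) (c) : Measurable fun x => surplus p (s x) (d x) c := by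
  rcases c with (i | i) | _
  · exact (measurable_served hd i).sub ((measurable_arrival hs _).mul_const _)
  · exact (measurable_nrtBits hs hd i).sub ((measurable_admInd hd i).const_mul _)
  · exact measurable_const.sub (measurable_slotPower p hd)

lemma measurable_admitted {d : α → Action R N} (hd : Measurable d) :
    Measurable fun x => admitted (d x) :=
  Finset.measurable_sum _ fun i _ => measurable_admInd hd i

end Drift

/-! ### Decoupling -/

section Decoupling

variable {Ω S ι : Type*} [MeasurableSpace Ω] {μ : Measure Ω} [IsProbabilityMeasure μ]
  [Fintype S] [MeasurableSpace S] [MeasurableSingletonClass S] [Fintype ι]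

lemma sum_setIntegral_fiber {Z : Ω → S} (hZ : Measurable Z) {f : Ω → ℝ} (hf : Integrable f μ) :
    ∑ s, ∫ ω in Z ⁻¹' {s}, f ω ∂μ = ∫ ω, f ω ∂μ := by
  have h := integral_iUnion_fintype (μ := μ) (f := f) (s := fun s => Z ⁻¹' {s})
    (fun s => hZ (measurableSet_singleton s))
    (fun s t hst => Disjoint.preimage _ (Set.disjoint_singleton.2 hst))
    (fun s => hf.integrableOn)
  rw [← h, ← Set.preimage_iUnion, Set.iUnion_of_singleton, Set.preimage_univ, setIntegral_univ]

/-- If `U` is independent of `Z`, and if `∑ c, U_c W_c + V` is a lower bound for `G` whenever `W`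
and `V` are evaluated at a point with the same observation, then in expectation `U` may be
replaced by its mean. -/
lemma sum_integral_mul_integral_le {Z Z' : Ω → S} (hZ : Measurable Z) (hZ' : Measurable Z')
    (hlaw : ∀ s, μ.real (Z ⁻¹' {s}) = μ.real (Z' ⁻¹' {s})) {U W : ι → Ω → ℝ} {V G : Ω → ℝ}
    (hU : ∀ c, Integrable (U c) μ) (hW : ∀ c, Integrable (W c) μ) (hV : Integrable V μ)
    (hG : Integrable G μ)
    (hind : ∀ c s, ∫ ω in Z ⁻¹' {s}, U c ω ∂μ = μ.real (Z ⁻¹' {s}) * ∫ ω, U c ω ∂μ)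
    (h : ∀ ω ω', Z ω = Z' ω' → ∑ c, U c ω * W c ω' + V ω' ≤ G ω) :
    ∑ c, (∫ ω, U c ω ∂μ) * (∫ ω, W c ω ∂μ) + ∫ ω, V ω ∂μ ≤ ∫ ω, G ω ∂μ := by
  have key : ∀ s, ∑ c, (∫ ω, U c ω ∂μ) * (∫ ω in Z' ⁻¹' {s}, W c ω ∂μ)
      + ∫ ω in Z' ⁻¹' {s}, V ω ∂μ ≤ ∫ ω in Z ⁻¹' {s}, G ω ∂μ := by
    intro s
    have hs : MeasurableSet (Z ⁻¹' {s}) := hZ (measurableSet_singleton s)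
    have hs' : MeasurableSet (Z' ⁻¹' {s}) := hZ' (measurableSet_singleton s)
    set P := μ.real (Z ⁻¹' {s}) with hP
    have hP' : μ.real (Z' ⁻¹' {s}) = P := (hlaw s).symm
    rcases (measureReal_nonneg : 0 ≤ P).eq_or_lt with h0 | hpos
    · have e : μ (Z ⁻¹' {s}) = 0 := by
        rw [← measureReal_eq_zero_iff]; exact h0.symm
      have e' : μ (Z' ⁻¹' {s}) = 0 := by
        rw [← measureReal_eq_zero_iff, hP']; exact h0.symm
      simp [Measure.restrict_eq_zero.2 e, Measure.restrict_eq_zero.2 e']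
    -- Integrate the pointwise bound over `ω'` in the fibre of `Z'`, then over `ω` in the fibre of
    -- `Z`. Each side acquires the factor `P`: on the left from independence and from the constant
    -- term, on the right from the constant `G ω`. It then cancels.
    · have step1 : ∀ ω ∈ Z ⁻¹' {s}, ∑ c, U c ω * (∫ ω' in Z' ⁻¹' {s}, W c ω' ∂μ)
          + ∫ ω' in Z' ⁻¹' {s}, V ω' ∂μ ≤ P * G ω := by
        intro ω hω
        have hint : ∀ c, IntegrableOn (fun ω' => U c ω * W c ω') (Z' ⁻¹' {s}) μ :=
          fun c => ((hW c).const_mul _).integrableOn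
        calc ∑ c, U c ω * (∫ ω' in Z' ⁻¹' {s}, W c ω' ∂μ) + ∫ ω' in Z' ⁻¹' {s}, V ω' ∂μ
            = ∫ ω' in Z' ⁻¹' {s}, (∑ c, U c ω * W c ω' + V ω') ∂μ := by
              rw [integral_add (integrable_finsetSum _ fun c _ => hint c) hV.integrableOn,
                integral_finsetSum _ fun c _ => hint c]
              simp_rw [integral_const_mul]
          _ ≤ ∫ _ω' in Z' ⁻¹' {s}, G ω ∂μ := by
              refine setIntegral_mono_on ((integrable_finsetSum _ fun c _ => hint c).add
                hV.integrableOn) (integrable_const _) hs' fun ω' hω' => h ω ω' ?_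
              rw [Set.mem_preimage, Set.mem_singleton_iff] at hω hω'
              rw [hω, hω']
          _ = P * G ω := by rw [setIntegral_const, hP', smul_eq_mul]
      have hint : ∀ c, IntegrableOn (fun ω => U c ω * (∫ ω' in Z' ⁻¹' {s}, W c ω' ∂μ))
          (Z ⁻¹' {s}) μ := fun c => ((hU c).mul_const _).integrableOn
      have step2 := setIntegral_mono_on (μ := μ) ((integrable_finsetSum _ fun c _ => hint c).add
        (integrable_const _)) (hG.const_mul P).integrableOn hs step1
      simp only [Pi.add_apply] at step2
      rw [integral_add (integrable_finsetSum _ fun c _ => hint c) (integrable_const _),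
        integral_finsetSum _ fun c _ => hint c, integral_const_mul, setIntegral_const,
        smul_eq_mul] at step2
      simp_rw [integral_mul_const, hind] at step2
      rw [← hP] at step2
      simp_rw [mul_assoc] at step2
      rw [← Finset.mul_sum, ← mul_add] at step2
      exact le_of_mul_le_mul_left step2 hpos
  have hsum := Finset.sum_le_sum fun s (_ : s ∈ Finset.univ) => key s
  rw [Finset.sum_add_distrib, Finset.sum_comm, sum_setIntegral_fiber hZ' hV,
    sum_setIntegral_fiber hZ hG] at hsum
  simp_rw [← Finset.mul_sum, sum_setIntegral_fiber hZ' (hW _)] at hsum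
  exact hsum

end Decoupling

lemma setIntegral_fiber_of_indep {Ω S : Type*} {m mΩ : MeasurableSpace Ω} {μ : Measure Ω}
    [MeasurableSpace S] [MeasurableSingletonClass S] {Z : Ω → S} (hZ : Measurable Z)
    {f : Ω → ℝ} (hm : m ≤ mΩ) (hf : Measurable[m] f)
    (hind : Indep (MeasurableSpace.comap Z inferInstance) m μ) (s : S) :
    ∫ ω in Z ⁻¹' {s}, f ω ∂μ = μ.real (Z ⁻¹' {s}) * ∫ ω, f ω ∂μ :=
  Indep.setIntegral_eq_mul (f := id) hZ.comap_le (indep_of_indep_of_le_right hind hf.comap_le)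
    (hf.mono hm le_rfl).aemeasurable ⟨{s}, measurableSet_singleton s, rfl⟩
    measurable_id.aestronglyMeasurable

/-! ### Time averages -/

section TimeAverages

lemma timeAvg_mono {f g : ℕ → ℝ} (h : ∀ k, f k ≤ g k) (K : ℕ) : timeAvg f K ≤ timeAvg g K :=
  div_le_div_of_nonneg_right (Finset.sum_le_sum fun k _ => h k) K.cast_nonneg

lemma timeAvg_const (x : ℝ) {K : ℕ} (hK : K ≠ 0) : timeAvg (fun _ => x) K = x := by
  have : (K : ℝ) ≠ 0 := by exact_mod_cast hK
  simp [timeAvg, this]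

lemma timeAvg_add (f g : ℕ → ℝ) (K : ℕ) :
    timeAvg (fun k => f k + g k) K = timeAvg f K + timeAvg g K := by
  simp [timeAvg, Finset.sum_add_distrib, add_div]

lemma timeAvg_sub (f g : ℕ → ℝ) (K : ℕ) :
    timeAvg (fun k => f k - g k) K = timeAvg f K - timeAvg g K := by
  simp [timeAvg, Finset.sum_sub_distrib, sub_div]

lemma timeAvg_const_mul (x : ℝ) (f : ℕ → ℝ) (K : ℕ) :
    timeAvg (fun k => x * f k) K = x * timeAvg f K := by
  simp [timeAvg, ← Finset.mul_sum, mul_div_assoc]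

lemma timeAvg_sum {ι : Type*} (s : Finset ι) (f : ι → ℕ → ℝ) (K : ℕ) :
    timeAvg (fun k => ∑ c ∈ s, f c k) K = ∑ c ∈ s, timeAvg (f c) K := by
  simp only [timeAvg]
  rw [Finset.sum_comm, Finset.sum_div]

lemma timeAvg_telescope (h : ℕ → ℝ) (K : ℕ) :
    timeAvg (fun k => h k - h (k + 1)) K = (h 0 - h K) / K := by
  rw [timeAvg, Finset.sum_range_sub']

lemma timeAvg_mem {f : ℕ → ℝ} {a b : ℝ} (h : ∀ k, f k ∈ Set.Icc a b) {K : ℕ} (hK : K ≠ 0) :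
    timeAvg f K ∈ Set.Icc a b := by
  constructor
  · rw [← timeAvg_const a hK]; exact timeAvg_mono (fun k => (h k).1) K
  · rw [← timeAvg_const b hK]; exact timeAvg_mono (fun k => (h k).2) K

lemma eventually_timeAvg_mem {f : ℕ → ℝ} {a b : ℝ} (h : ∀ k, f k ∈ Set.Icc a b) :
    ∀ᶠ K in atTop, timeAvg f K ∈ Set.Icc a b :=
  (eventually_ne_atTop 0).mono fun _ hK => timeAvg_mem h hK

/-- The bounds on `f` are what makes the real-valued `liminf` meaningful, since `ℝ` is only
conditionally complete. -/
lemma le_liminf_timeAvg_iff {f : ℕ → ℝ} {a b x : ℝ} (h : ∀ k, f k ∈ Set.Icc a b) :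
    x ≤ liminf (timeAvg f) atTop ↔ ∀ ε > 0, ∀ᶠ K in atTop, x - ε ≤ timeAvg f K := by
  have hev := eventually_timeAvg_mem h
  constructor
  · intro hx ε hε
    refine (eventually_lt_of_lt_liminf (b := x - ε) (by linarith)
      (isBoundedUnder_of_eventually_ge (hev.mono fun _ hK => hK.1))).mono fun _ hK => hK.le
  · intro hx
    refine le_of_forall_sub_le fun ε hε => ?_
    exact le_liminf_of_le
      (isBoundedUnder_of_eventually_le (hev.mono fun _ hK => hK.2)).isCoboundedUnder_ge (hx ε hε)

lemma limsup_timeAvg_le_iff {f : ℕ → ℝ} {a b x : ℝ} (h : ∀ k, f k ∈ Set.Icc a b) :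
    limsup (timeAvg f) atTop ≤ x ↔ ∀ ε > 0, ∀ᶠ K in atTop, timeAvg f K ≤ x + ε := by
  have hev := eventually_timeAvg_mem h
  constructor
  · intro hx ε hε
    refine (eventually_lt_of_limsup_lt (b := x + ε) (by linarith)
      (isBoundedUnder_of_eventually_le (hev.mono fun _ hK => hK.2))).mono fun _ hK => hK.le
  · intro hx
    refine le_of_forall_pos_le_add fun ε hε => ?_
    exact limsup_le_of_le
      (isBoundedUnder_of_eventually_ge (hev.mono fun _ hK => hK.1)).isCoboundedUnder_le (hx ε hε)

lemma eventually_const_div_ge (C : ℝ) {ε : ℝ} (hε : 0 < ε) :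
    ∀ᶠ K : ℕ in atTop, -ε ≤ C / K :=
  (tendsto_const_div_atTop_nhds_zero_nat C).eventually_const_le (by linarith)

end TimeAverages

/-! ### Expectations along a trajectory -/

section Trajectory

variable {R N Ω : Type*} [Fintype R] [Fintype N] [mΩ : MeasurableSpace Ω] {μ : Measure Ω}
  [IsProbabilityMeasure μ] {ℱ : Filtration ℕ mΩ} {p : Params R} {lam : R → ℝ} {B : ℝ}
  {obs : ℕ → Ω → Slot R N} {u₀ : State R N} {π π' : ℕ → Ω → Action R N}

lemma integrable_of_mem_Icc {f : Ω → ℝ} (hf : Measurable f) {a b : ℝ}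
    (h : ∀ ω, f ω ∈ Set.Icc a b) : Integrable f μ :=
  Integrable.of_mem_Icc a b hf.aemeasurable (ae_of_all _ h)

lemma integral_mem_Icc {f : Ω → ℝ} (hf : Measurable f) {a b : ℝ}
    (h : ∀ ω, f ω ∈ Set.Icc a b) : ∫ ω, f ω ∂μ ∈ Set.Icc a b := by
  have hint : Integrable f μ := integrable_of_mem_Icc hf h
  constructor
  · calc a = ∫ _ω, a ∂μ := by simp
      _ ≤ _ := integral_mono (integrable_const _) hint fun ω => (h ω).1
  · calc ∫ ω, f ω ∂μ ≤ ∫ _ω, b ∂μ := integral_mono hint (integrable_const _) fun ω => (h ω).2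
      _ = b := by simp

lemma IsPolicy.measurable' (hπ : IsPolicy ℱ π) (k : ℕ) : Measurable (π k) :=
  (hπ.measurable k).mono (ℱ.le k) le_rfl

lemma measurable_queues (hobs : ∀ k, Measurable[ℱ k] (obs k)) (hπ : IsPolicy ℱ π) (k : ℕ) :
    Measurable (queues p u₀ obs π k) := by
  cases k with
  | zero => exact measurable_const
  | succ k => exact (measurable_queues_succ p u₀ hobs hπ k).mono (ℱ.le k) le_rfl

lemma levels_queues_succ (k : ℕ) (ω : Ω) (c) :
    levels (queues p u₀ obs π (k + 1) ω) c =
      max (levels (queues p u₀ obs π k ω) c - surplus p (obs k ω) (π k ω) c) 0 :=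
  levels_step c

lemma levels_queues_nonneg (hu₀ : u₀.Nonneg) (k : ℕ) (ω : Ω) (c) :
    0 ≤ levels (queues p u₀ obs π k ω) c :=
  levels_nonneg (queues_nonneg p hu₀ obs π k ω) c

lemma levels_queues_succ_le (hval : ∀ k ω, (π k ω).Valid p (obs k ω)) (hu₀ : u₀.Nonneg)
    (k : ℕ) (ω : Ω) (c) :
    levels (queues p u₀ obs π (k + 1) ω) c ≤
      levels (queues p u₀ obs π k ω) c + √(2 * C1 p N) := by
  have h := abs_le.1 (abs_surplus_le (hval k ω) c)
  have h0 := levels_queues_nonneg (p := p) (obs := obs) (π := π) hu₀ k ω c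
  rw [levels_queues_succ]
  exact max_le (by linarith) (by linarith [Real.sqrt_nonneg (2 * C1 p N)])

lemma levels_queues_le (hval : ∀ k ω, (π k ω).Valid p (obs k ω)) (hu₀ : u₀.Nonneg)
    (k : ℕ) (ω : Ω) (c) :
    levels (queues p u₀ obs π k ω) c ≤ levels u₀ c + k * √(2 * C1 p N) := by
  induction k with
  | zero => simp [queues]
  | succ k ih =>
    have := levels_queues_succ_le hval hu₀ k ω c
    push_cast
    linarith

lemma measurable_levels_queues (hobs : ∀ k, Measurable[ℱ k] (obs k)) (hπ : IsPolicy ℱ π)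
    (k : ℕ) (c) : Measurable fun ω => levels (queues p u₀ obs π k ω) c :=
  (measurable_levels c).comp (measurable_queues hobs hπ k)

lemma measurable_surplus_policy (hobs : ∀ k, Measurable[ℱ k] (obs k)) (hπ : IsPolicy ℱ π)
    (k : ℕ) (c) : Measurable fun ω => surplus p (obs k ω) (π k ω) c :=
  measurable_surplus p ((hobs k).mono (ℱ.le k) le_rfl) (hπ.measurable' k) c

lemma integrable_levels
    (hobs : ∀ k, Measurable[ℱ k] (obs k)) (hπ : IsPolicy ℱ π)
    (hval : ∀ k ω, (π k ω).Valid p (obs k ω)) (hu₀ : u₀.Nonneg)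
    (k : ℕ) (c) :
    Integrable (fun ω => levels (queues p u₀ obs π k ω) c) μ :=
  integrable_of_mem_Icc (measurable_levels_queues hobs hπ k c) fun ω =>
    ⟨levels_queues_nonneg hu₀ k ω c, levels_queues_le hval hu₀ k ω c⟩

lemma integrable_levels_sq
    (hobs : ∀ k, Measurable[ℱ k] (obs k)) (hπ : IsPolicy ℱ π)
    (hval : ∀ k ω, (π k ω).Valid p (obs k ω)) (hu₀ : u₀.Nonneg)
    (k : ℕ) (c) :
    Integrable (fun ω => levels (queues p u₀ obs π k ω) c ^ 2) μ :=
  integrable_of_mem_Icc ((measurable_levels_queues hobs hπ k c).pow_const 2) fun ω =>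
    ⟨sq_nonneg _, pow_le_pow_left₀ (levels_queues_nonneg hu₀ k ω c)
      (levels_queues_le hval hu₀ k ω c) 2⟩

lemma integrable_lyapunov
    (hobs : ∀ k, Measurable[ℱ k] (obs k)) (hπ : IsPolicy ℱ π)
    (hval : ∀ k ω, (π k ω).Valid p (obs k ω)) (hu₀ : u₀.Nonneg)
    (k : ℕ) :
    Integrable (fun ω => lyapunov (queues p u₀ obs π k ω)) μ :=
  (integrable_finsetSum _ fun c _ => integrable_levels_sq hobs hπ hval hu₀ k c).div_const 2

lemma integrable_surplus
    (hobs : ∀ k, Measurable[ℱ k] (obs k)) (hπ : IsPolicy ℱ π)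
    (hval : ∀ k ω, (π k ω).Valid p (obs k ω))
    (k : ℕ) (c) :
    Integrable (fun ω => surplus p (obs k ω) (π k ω) c) μ :=
  integrable_of_mem_Icc (measurable_surplus_policy hobs hπ k c) fun ω =>
    abs_le.1 (abs_surplus_le (hval k ω) c)

lemma integrable_levels_mul_surplus
    (hobs : ∀ k, Measurable[ℱ k] (obs k)) (hπ : IsPolicy ℱ π)
    (hval : ∀ k ω, (π k ω).Valid p (obs k ω)) (hu₀ : u₀.Nonneg)
    (k : ℕ) (c) :
    Integrable (fun ω => levels (queues p u₀ obs π k ω) c * surplus p (obs k ω) (π k ω) c) μ :=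
  (integrable_levels hobs hπ hval hu₀ k c).mul_bdd
    (measurable_surplus_policy hobs hπ k c).aestronglyMeasurable
    (ae_of_all _ fun ω => abs_surplus_le (hval k ω) c)

/-- The surplus of a queue is, on average, at least the decrease of its mean. -/
lemma sub_le_integral_surplus
    (hobs : ∀ k, Measurable[ℱ k] (obs k)) (hπ : IsPolicy ℱ π)
    (hval : ∀ k ω, (π k ω).Valid p (obs k ω)) (hu₀ : u₀.Nonneg)
    (k : ℕ) (c) :
    ∫ ω, levels (queues p u₀ obs π k ω) c ∂μ - ∫ ω, levels (queues p u₀ obs π (k + 1) ω) c ∂μ ≤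
      ∫ ω, surplus p (obs k ω) (π k ω) c ∂μ := by
  rw [← integral_sub (integrable_levels hobs hπ hval hu₀ k c)
    (integrable_levels hobs hπ hval hu₀ (k + 1) c)]
  refine integral_mono ((integrable_levels hobs hπ hval hu₀ k c).sub
    (integrable_levels hobs hπ hval hu₀ (k + 1) c)) (integrable_surplus hobs hπ hval k c)
    fun ω => ?_
  dsimp only
  rw [levels_queues_succ]
  linarith [le_max_left (levels (queues p u₀ obs π k ω) c - surplus p (obs k ω) (π k ω) c) 0]

lemma integrable_admitted (hπ : IsPolicy ℱ π) (k : ℕ) :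
    Integrable (fun ω => admitted (π k ω)) μ :=
  integrable_of_mem_Icc (measurable_admitted (hπ.measurable' k)) fun _ => admitted_mem _

lemma integral_arrival (hobs : IsOnOffModel μ ℱ obs lam) (k : ℕ) (i : R) :
    ∫ ω, ind ((obs k ω).1 (Sum.inl i)) ∂μ = lam i := by
  have hm : Measurable fun s : Slot R N => ind (s.1 (Sum.inl i)) :=
    measurable_arrival measurable_id _
  have h0 : Measurable (obs 0) := (hobs.measurable 0).mono (ℱ.le 0) le_rfl
  have hset : MeasurableSet {ω | (obs 0 ω).1 (Sum.inl i) = true} :=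
    ((measurable_pi_apply (Sum.inl i)).comp h0.fst) (measurableSet_singleton true)
  have h := ((hobs.identDistrib k).comp hm).integral_eq
  simp only [Function.comp_def] at h
  rw [h, ← hobs.arrival i, ← integral_indicator_one hset]
  refine integral_congr_ae (ae_of_all _ fun ω => ?_)
  simp [ind, Set.indicator_apply]

/-- The queues at the beginning of a slot are independent of the observation in that slot. -/
lemma setIntegral_levels (hobs : IsOnOffModel μ ℱ obs lam) (hπ : IsPolicy ℱ π) (k : ℕ) (c)
    (s : Slot R N) :
    ∫ ω in obs k ⁻¹' {s}, levels (queues p u₀ obs π k ω) c ∂μ =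
      μ.real (obs k ⁻¹' {s}) * ∫ ω, levels (queues p u₀ obs π k ω) c ∂μ := by
  cases k with
  | zero => simp [queues]
  | succ k =>
    exact setIntegral_fiber_of_indep ((hobs.measurable (k + 1)).mono (ℱ.le _) le_rfl) (ℱ.le k)
      ((measurable_levels c).comp (measurable_queues_succ p u₀ hobs.measurable hπ k))
      (hobs.indep k) s

lemma IsAlgorithm.valid (hu₀ : u₀.Nonneg) (h : IsAlgorithm ℱ p B u₀ obs π) (k : ℕ) (ω : Ω) :
    (π k ω).Valid p (obs k ω) :=
  ((h.decision k ω).valid_and_gain_le (queues_nonneg p hu₀ obs π k ω)).1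

/-- One-slot comparison of the algorithm in slot `k` with any other policy in slot `j`. -/
lemma IsAlgorithm.drift_le (hobs : IsOnOffModel μ ℱ obs lam) (hu₀ : u₀.Nonneg)
    (h : IsAlgorithm ℱ p B u₀ obs π) (hπ' : IsPolicy ℱ π')
    (hval' : ∀ k ω, (π' k ω).Valid p (obs k ω)) (k j : ℕ) :
    ∫ ω, lyapunov (queues p u₀ obs π (k + 1) ω) ∂μ
      + (∑ c, (∫ ω, levels (queues p u₀ obs π k ω) c ∂μ)
          * (∫ ω, surplus p (obs j ω) (π' j ω) c ∂μ)
        + B * p.L * ∫ ω, admitted (π' j ω) ∂μ) ≤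
    ∫ ω, lyapunov (queues p u₀ obs π k ω) ∂μ + C1 p N
      + B * p.L * ∫ ω, admitted (π k ω) ∂μ := by
  have hval := h.valid hu₀
  have hm := hobs.measurable
  have := Fintype.ofFinite (Slot R N)
  have hsum : Integrable (fun ω => ∑ c, levels (queues p u₀ obs π k ω) c
      * surplus p (obs k ω) (π k ω) c) μ :=
    integrable_finsetSum _ fun c _ => integrable_levels_mul_surplus hm h.policy hval hu₀ k c
  have hadm := (integrable_admitted (μ := μ) h.policy k).const_mul (B * p.L)
  have hcomp := sum_integral_mul_integral_le (μ := μ) (Z := obs k) (Z' := obs j)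
    (U := fun c ω => levels (queues p u₀ obs π k ω) c)
    (W := fun c ω => surplus p (obs j ω) (π' j ω) c)
    (V := fun ω => B * p.L * admitted (π' j ω))
    (G := fun ω => ∑ c, levels (queues p u₀ obs π k ω) c * surplus p (obs k ω) (π k ω) c
      + B * p.L * admitted (π k ω))
    ((hm k).mono (ℱ.le k) le_rfl) ((hm j).mono (ℱ.le j) le_rfl)
    (fun s => by
      have := ((hobs.identDistrib k).trans (hobs.identDistrib j).symm).measure_preimage_eq
        (measurableSet_singleton s)
      rw [Measure.real, Measure.real, this])
    (fun c => integrable_levels hm h.policy hval hu₀ k c)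
    (fun c => integrable_surplus hm hπ' hval' j c)
    ((integrable_admitted hπ' j).const_mul _)
    (hsum.add hadm) (fun c s => setIntegral_levels hobs h.policy k c s)
    -- Validity depends on the observation alone. If the observations coincide, the competitor's
    -- decision at `ω'` is therefore valid against the algorithm's queues at `ω`, and the optimality
    -- of the algorithm applies.
    (fun ω ω' hω => by
      have hd' := hval' j ω'
      rw [← hω] at hd' ⊢
      exact (h.decision k ω).sum_levels_surplus_ge (queues_nonneg p hu₀ obs π k ω) hd')
  rw [integral_const_mul, integral_add hsum hadm, integral_const_mul] at hcomp
  have hV := integrable_lyapunov (μ := μ) hm h.policy hval hu₀ k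
  have hVC : Integrable (fun ω => lyapunov (queues p u₀ obs π k ω) + C1 p N) μ :=
    hV.add (integrable_const _)
  have hdrift := integral_mono (μ := μ) (integrable_lyapunov hm h.policy hval hu₀ (k + 1))
    (hVC.sub hsum) fun ω => lyapunov_step_le (u := queues p u₀ obs π k ω) (hval k ω)
  simp only [Pi.sub_apply] at hdrift
  rw [integral_sub hVC hsum, integral_add hV (integrable_const _)] at hdrift
  simp only [integral_const, probReal_univ, one_smul] at hdrift
  linarith

end Trajectory

open scoped Topology

/-! ### Rate stability -/

section RateStability

variable {Ω : Type*} [MeasurableSpace Ω] {μ : Measure Ω} [IsProbabilityMeasure μ]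

lemma tendsto_nat_sqrt : Tendsto Nat.sqrt atTop atTop :=
  tendsto_atTop.2 fun b => (eventually_ge_atTop (b * b)).mono fun _ hK => Nat.le_sqrt.2 hK

/-- A sequence with bounded increments grows sublinearly if it does so along the squares. -/
lemma tendsto_div_of_tendsto_squares {l : ℕ → ℝ} {M : ℝ} (h0 : ∀ k, 0 ≤ l k)
    (hinc : ∀ k, l (k + 1) ≤ l k + M) (hM : 0 ≤ M)
    (hsq : Tendsto (fun n : ℕ => l (n ^ 2) / (n : ℝ) ^ 2) atTop (𝓝 0)) :
    Tendsto (fun k : ℕ => l k / k) atTop (𝓝 0) := by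
  have hadd : ∀ m k, l (m + k) ≤ l m + k * M := by
    intro m k
    induction k with
    | zero => simp
    | succ k ih =>
      have := hinc (m + k)
      rw [← add_assoc]
      push_cast
      linarith
  have hlim : Tendsto (fun K : ℕ => l (K.sqrt ^ 2) / (K.sqrt : ℝ) ^ 2 + 2 * M / (K.sqrt : ℝ))
      atTop (𝓝 0) := by
    have := (hsq.add (tendsto_const_div_atTop_nhds_zero_nat (2 * M))).comp tendsto_nat_sqrt
    simpa [Function.comp_def] using this
  refine squeeze_zero' (Eventually.of_forall fun K => div_nonneg (h0 K) K.cast_nonneg)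
    ((eventually_ge_atTop 1).mono fun K hK => ?_) hlim
  -- Write `K = n ^ 2 + r` with `r ≤ 2 * n`: the increments since the last square contribute at most
  -- `2 * M / n` after division by `K`.
  set n := K.sqrt with hn
  have hn1 : 1 ≤ n := Nat.le_sqrt.2 (by simpa using hK)
  have hle : n ^ 2 ≤ K := by rw [pow_two]; exact Nat.sqrt_le K
  obtain ⟨r, hr⟩ := Nat.exists_eq_add_of_le hle
  have hr2 : r ≤ 2 * n := by
    have := Nat.sqrt_le_add K
    rw [← hn] at this
    nlinarith
  have hnpos : (0 : ℝ) < n := by exact_mod_cast hn1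
  have hK' : (n : ℝ) ^ 2 ≤ K := by exact_mod_cast hle
  have hKpos : (0 : ℝ) < K := lt_of_lt_of_le (by positivity) hK'
  have hr3 : (r : ℝ) ≤ 2 * n := by exact_mod_cast hr2
  have h1 : l K ≤ l (n ^ 2) + 2 * n * M := by
    have := hadd (n ^ 2) r
    rw [← hr] at this
    nlinarith
  calc l K / K ≤ (l (n ^ 2) + 2 * n * M) / K := by gcongr
    _ ≤ (l (n ^ 2) + 2 * n * M) / (n : ℝ) ^ 2 := by
        have := h0 (n ^ 2)
        gcongr
    _ = l (n ^ 2) / (n : ℝ) ^ 2 + 2 * M / n := by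
        field_simp

/-- A nonnegative process with bounded increments whose second moment grows at most linearly is
almost surely sublinear. -/
lemma ae_tendsto_div_zero {l : ℕ → Ω → ℝ} {M a b : ℝ} (hl : ∀ k, Measurable (l k))
    (h0 : ∀ k ω, 0 ≤ l k ω) (hinc : ∀ k ω, l (k + 1) ω ≤ l k ω + M) (hM : 0 ≤ M)
    (hint : ∀ k, Integrable (fun ω => l k ω ^ 2) μ) (ha : 0 ≤ a)
    (hsq : ∀ k : ℕ, ∫ ω, l k ω ^ 2 ∂μ ≤ a + b * k) :
    ∀ᵐ ω ∂μ, Tendsto (fun k : ℕ => l k ω / k) atTop (𝓝 0) := by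
  -- Along the squares the means of these terms are bounded by `(a + b) / n ^ 2`, which is summable.
  -- The random series therefore converges almost surely and its terms tend to `0`; bounded
  -- increments fill the gaps.
  set f : ℕ → Ω → ℝ := fun n ω => (l (n ^ 2) ω / (n : ℝ) ^ 2) ^ 2 with hf
  have hfm : ∀ n, Measurable (f n) := fun n => ((hl _).div_const _).pow_const 2
  have hfint : ∀ n, Integrable (f n) μ := fun n => by
    simp only [hf, div_pow]
    exact (hint _).div_const _
  have hbound : ∀ n : ℕ, ∫ ω, f n ω ∂μ ≤ (a + b) * (1 / (n : ℝ) ^ 2) := fun n => by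
    simp only [hf, div_pow]
    rw [integral_div]
    rcases Nat.eq_zero_or_pos n with rfl | hn
    · simp
    have hn' : (1 : ℝ) ≤ (n : ℝ) ^ 2 := by
      have : (1 : ℝ) ≤ n := by exact_mod_cast hn
      nlinarith
    have h := hsq (n ^ 2)
    push_cast at h
    rw [div_le_iff₀ (by positivity)]
    calc _ ≤ a + b * (n : ℝ) ^ 2 := h
      _ ≤ (a + b) * (n : ℝ) ^ 2 := by nlinarith
      _ = _ := by field_simp
  have hsum : ∑' n, ∫⁻ ω, ENNReal.ofReal (f n ω) ∂μ ≠ ⊤ := by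
    have hs : Summable fun n : ℕ => (a + b) * (1 / (n : ℝ) ^ 2) :=
      (Real.summable_one_div_nat_pow.2 one_lt_two).mul_left _
    refine ne_top_of_le_ne_top hs.tsum_ofReal_ne_top (ENNReal.tsum_le_tsum fun n => ?_)
    rw [← ofReal_integral_eq_lintegral_ofReal (hfint n) (ae_of_all _ fun ω => sq_nonneg _)]
    exact ENNReal.ofReal_le_ofReal (hbound n)
  rw [← lintegral_tsum fun n => (hfm n).ennreal_ofReal.aemeasurable] at hsum
  have hae := ae_lt_top (Measurable.tsum fun n => (hfm n).ennreal_ofReal) hsum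
  filter_upwards [hae] with ω hω
  refine tendsto_div_of_tendsto_squares (h0 · ω) (hinc · ω) hM ?_
  have h1 := ENNReal.tendsto_atTop_zero_of_tsum_ne_top hω.ne
  have h2 := (ENNReal.tendsto_toReal ENNReal.zero_ne_top).comp h1
  have h3 := (Real.continuous_sqrt.tendsto 0).comp h2
  rw [Real.sqrt_zero] at h3
  refine h3.congr fun n => ?_
  simp only [Function.comp_apply]
  rw [ENNReal.toReal_ofReal (sq_nonneg _), Real.sqrt_sq (div_nonneg (h0 _ _) (by positivity))]

/-- Dominated convergence, with the linear growth bound supplying the constant dominating function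
`C + M`. -/
lemma tendsto_integral_div_zero {l : ℕ → Ω → ℝ} {M C : ℝ} (hl : ∀ k, Measurable (l k))
    (h0 : ∀ k ω, 0 ≤ l k ω) (hle : ∀ (k : ℕ) ω, l k ω ≤ C + k * M) (hC : 0 ≤ C) (hM : 0 ≤ M)
    (h : ∀ᵐ ω ∂μ, Tendsto (fun k : ℕ => l k ω / k) atTop (𝓝 0)) :
    Tendsto (fun k : ℕ => (∫ ω, l k ω ∂μ) / k) atTop (𝓝 0) := by
  have key := tendsto_integral_of_dominated_convergence (μ := μ) (F := fun k ω => l k ω / k)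
    (f := fun _ => 0) (fun _ => C + M) (fun k => ((hl k).div_const _).aestronglyMeasurable)
    (integrable_const _) (fun k => ae_of_all _ fun ω => ?_) h
  · simpa [integral_div] using key
  · rw [Real.norm_of_nonneg (div_nonneg (h0 k ω) k.cast_nonneg)]
    rcases Nat.eq_zero_or_pos k with rfl | hk
    · simpa using add_nonneg hC hM
    · have hk' : (1 : ℝ) ≤ k := by exact_mod_cast hk
      rw [div_le_iff₀ (by linarith)]
      nlinarith [hle k ω]

end RateStability

/-! ### Throughput and constraints -/

section Performance

variable {R N Ω : Type*} [Fintype R] [Fintype N] [mΩ : MeasurableSpace Ω] {μ : Measure Ω}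
  [IsProbabilityMeasure μ] {ℱ : Filtration ℕ mΩ} {p : Params R} {lam : R → ℝ} {B : ℝ}
  {obs : ℕ → Ω → Slot R N} {u₀ : State R N} {π π' : ℕ → Ω → Action R N}

lemma packets_inl (hval : ∀ k ω, (π k ω).Valid p (obs k ω)) (i : R) (k : ℕ) (ω : Ω) :
    packets p u₀ obs π (Sum.inl i) k ω = served (π k ω) i := by
  have h : packets p u₀ obs π (Sum.inl i) k ω =
    (π k ω).dur (Sum.inl i) * rate (obs k ω) (π k ω) (Sum.inl i) / p.L := rfl
  have hL := p.L_pos.ne'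
  rw [h, rt_bits (hval k ω), mul_div_cancel_left₀ _ hL]

/-- The buffered data that is not delivered stays in the queue. -/
lemma packets_inr (i : N) (k : ℕ) (ω : Ω) :
    packets p u₀ obs π (Sum.inr i) k ω =
      (levels (queues p u₀ obs π k ω) (Sum.inl (Sum.inr i))
        - levels (queues p u₀ obs π (k + 1) ω) (Sum.inl (Sum.inr i))) / p.L
        + ind ((π k ω).adm i) := by
  have hL := p.L_pos.ne'
  have h : packets p u₀ obs π (Sum.inr i) k ω =
    min ((π k ω).dur (Sum.inr i) * rate (obs k ω) (π k ω) (Sum.inr i))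
      ((queues p u₀ obs π k ω).Q i + p.L * ind ((π k ω).adm i)) / p.L := rfl
  have h' : levels (queues p u₀ obs π (k + 1) ω) (Sum.inl (Sum.inr i)) =
    max ((queues p u₀ obs π k ω).Q i + p.L * ind ((π k ω).adm i)
      - (π k ω).dur (Sum.inr i) * rate (obs k ω) (π k ω) (Sum.inr i)) 0 := rfl
  have h'' : levels (queues p u₀ obs π k ω) (Sum.inl (Sum.inr i)) =
    (queues p u₀ obs π k ω).Q i := rfl
  rw [h, h', h'']
  set x := (π k ω).dur (Sum.inr i) * rate (obs k ω) (π k ω) (Sum.inr i)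
  set y := (queues p u₀ obs π k ω).Q i
  rcases le_total x (y + p.L * ind ((π k ω).adm i)) with hc | hc
  · rw [min_eq_left hc, max_eq_left (by linarith)]
    field_simp
    ring
  · rw [min_eq_right hc, max_eq_right (by linarith)]
    field_simp
    ring

lemma packets_inr_mem (hval : ∀ k ω, (π k ω).Valid p (obs k ω)) (hu₀ : u₀.Nonneg)
    (i : N) (k : ℕ) (ω : Ω) : packets p u₀ obs π (Sum.inr i) k ω ∈
      Set.Icc 0 (p.T * Real.log (1 + p.Pmax) / p.L) := by
  have hL := p.L_pos
  have hb := nrtBits_mem (hval k ω) (Sum.inr i)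
  have hQ := (queues_nonneg p hu₀ obs π k ω).2.1 i
  exact ⟨div_nonneg (le_min hb.1 (add_nonneg hQ (mul_nonneg hL.le (ind_nonneg _)))) hL.le,
    div_le_div_of_nonneg_right ((min_le_left _ _).trans hb.2) hL.le⟩

lemma measurable_packets_inr (hobs : ∀ k, Measurable[ℱ k] (obs k)) (hπ : IsPolicy ℱ π)
    (i : N) (k : ℕ) : Measurable fun ω => packets p u₀ obs π (Sum.inr i) k ω := by
  simp_rw [packets_inr]
  exact (((measurable_levels_queues hobs hπ k _).sub
    (measurable_levels_queues hobs hπ (k + 1) _)).div_const _).add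
    (measurable_admInd (hπ.measurable' k) i)

lemma sum_integral_packets_mem
    (hobs : ∀ k, Measurable[ℱ k] (obs k)) (hπ : IsPolicy ℱ π)
    (hval : ∀ k ω, (π k ω).Valid p (obs k ω)) (hu₀ : u₀.Nonneg)
    (k : ℕ) :
    ∑ i : N, ∫ ω, packets p u₀ obs π (Sum.inr i) k ω ∂μ ∈
      Set.Icc 0 (∑ _i : N, p.T * Real.log (1 + p.Pmax) / p.L) := by
  have h : ∀ i : N, ∫ ω, packets p u₀ obs π (Sum.inr i) k ω ∂μ ∈
      Set.Icc 0 (p.T * Real.log (1 + p.Pmax) / p.L) := fun i =>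
    integral_mem_Icc (measurable_packets_inr hobs hπ i k) (packets_inr_mem hval hu₀ i k)
  exact ⟨Finset.sum_nonneg fun i _ => (h i).1, Finset.sum_le_sum fun i _ => (h i).2⟩

/-- Each slot delivers what is admitted plus the decrease of the buffers, and the latter telescopes.
Delivered and admitted rates thus differ only by a boundary term. -/
lemma timeAvg_sum_integral_packets
    (hobs : ∀ k, Measurable[ℱ k] (obs k)) (hπ : IsPolicy ℱ π)
    (hval : ∀ k ω, (π k ω).Valid p (obs k ω)) (hu₀ : u₀.Nonneg)
    (K : ℕ) :
    timeAvg (fun k => ∑ i : N, ∫ ω, packets p u₀ obs π (Sum.inr i) k ω ∂μ) K =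
      (∑ i : N, levels u₀ (Sum.inl (Sum.inr i)) / p.L
        - ∑ i : N, (∫ ω, levels (queues p u₀ obs π K ω) (Sum.inl (Sum.inr i)) ∂μ) / p.L) / K
      + timeAvg (fun k => ∫ ω, admitted (π k ω) ∂μ) K := by
  set H : ℕ → ℝ := fun k =>
    ∑ i : N, (∫ ω, levels (queues p u₀ obs π k ω) (Sum.inl (Sum.inr i)) ∂μ) / p.L with hH
  have h0 : ∑ i : N, levels u₀ (Sum.inl (Sum.inr i)) / p.L = H 0 := by
    simp [hH, queues]
  have hk : ∀ k, ∑ i : N, ∫ ω, packets p u₀ obs π (Sum.inr i) k ω ∂μ =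
      (H k - H (k + 1)) + ∫ ω, admitted (π k ω) ∂μ := fun k => by
    have hadm : ∀ i : N, Integrable (fun ω => ind ((π k ω).adm i)) μ := fun i =>
      integrable_of_mem_Icc (measurable_admInd (hπ.measurable' k) i) fun _ =>
        ⟨ind_nonneg _, ind_le_one _⟩
    have hl := fun k (i : N) => integrable_levels (μ := μ) hobs hπ hval hu₀ k (Sum.inl (Sum.inr i))
    have hlk : ∀ i : N, Integrable (fun ω =>
        (levels (queues p u₀ obs π k ω) (Sum.inl (Sum.inr i))
          - levels (queues p u₀ obs π (k + 1) ω) (Sum.inl (Sum.inr i))) / p.L) μ :=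
      fun i => ((hl k i).sub (hl (k + 1) i)).div_const _
    simp only [hH, admitted, packets_inr]
    rw [integral_finsetSum _ fun i _ => hadm i, ← Finset.sum_sub_distrib,
      ← Finset.sum_add_distrib]
    refine Finset.sum_congr rfl fun i _ => ?_
    rw [integral_add (hlk i) (hadm i), integral_div, integral_sub (hl k i) (hl (k + 1) i), sub_div]
  simp_rw [hk]
  rw [timeAvg_add, timeAvg_telescope, h0]

lemma integral_surplus_inl (hobs : IsOnOffModel μ ℱ obs lam) (hπ : IsPolicy ℱ π) (i : R) (k : ℕ) :
    ∫ ω, surplus p (obs k ω) (π k ω) (Sum.inl (Sum.inl i)) ∂μ =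
      ∫ ω, served (π k ω) i ∂μ - lam i * p.q i := by
  have h1 : Integrable (fun ω => served (π k ω) i) μ :=
    integrable_of_mem_Icc (measurable_served (hπ.measurable' k) i) fun _ => served_mem _ i
  have h2 : Integrable (fun ω => ind ((obs k ω).1 (Sum.inl i)) * p.q i) μ :=
    (integrable_of_mem_Icc (measurable_arrival ((hobs.measurable k).mono (ℱ.le k) le_rfl) _)
      fun _ => ⟨ind_nonneg _, ind_le_one _⟩).mul_const _
  simp only [surplus]
  rw [integral_sub h1 h2, integral_mul_const, integral_arrival hobs]

lemma integral_surplus_inr (hπ : IsPolicy ℱ π) (hval : ∀ k ω, (π k ω).Valid p (obs k ω)) (k : ℕ) :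
    ∫ ω, surplus p (obs k ω) (π k ω) (Sum.inr ()) ∂μ =
      p.Pavg - ∫ ω, slotPower p (π k ω) ∂μ := by
  have h1 : Integrable (fun ω => slotPower p (π k ω)) μ :=
    integrable_of_mem_Icc (measurable_slotPower p (hπ.measurable' k)) fun ω =>
      slotPower_mem (hval k ω)
  simp only [surplus]
  rw [integral_sub (integrable_const _) h1]
  simp

lemma timeAvg_sub_const (f : ℕ → ℝ) (x : ℝ) {K : ℕ} (hK : K ≠ 0) :
    timeAvg (fun k => f k - x) K = timeAvg f K - x := by
  rw [timeAvg_sub, timeAvg_const x hK]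

lemma timeAvg_const_sub (f : ℕ → ℝ) (x : ℝ) {K : ℕ} (hK : K ≠ 0) :
    timeAvg (fun k => x - f k) K = x - timeAvg f K := by
  rw [timeAvg_sub, timeAvg_const x hK]

lemma integral_served_mem (hπ : IsPolicy ℱ π) (i : R) (k : ℕ) :
    ∫ ω, served (π k ω) i ∂μ ∈ Set.Icc (0 : ℝ) 1 :=
  integral_mem_Icc (measurable_served (hπ.measurable' k) i) fun _ => served_mem _ i

lemma integral_slotPower_mem (hπ : IsPolicy ℱ π) (hval : ∀ k ω, (π k ω).Valid p (obs k ω))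
    (k : ℕ) : ∫ ω, slotPower p (π k ω) ∂μ ∈ Set.Icc 0 p.Pmax :=
  integral_mem_Icc (measurable_slotPower p (hπ.measurable' k)) fun ω => slotPower_mem (hval k ω)

/-- Under a feasible policy no queue has, in the long run, more arrivals than service. -/
lemma IsFeasible.eventually_surplus (hobs : IsOnOffModel μ ℱ obs lam) (hu₀ : u₀.Nonneg)
    (h : IsFeasible μ ℱ p lam u₀ obs π) (c : (R ⊕ N) ⊕ Unit) {ε : ℝ} (hε : 0 < ε) :
    ∀ᶠ K in atTop, -ε ≤ timeAvg (fun k => ∫ ω, surplus p (obs k ω) (π k ω) c ∂μ) K := by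
  rcases c with (i | i) | _
  · have hd := h.delivery i
    simp_rw [packets_inl h.valid] at hd
    rw [le_liminf_timeAvg_iff (integral_served_mem h.policy i)] at hd
    filter_upwards [hd ε hε, eventually_ne_atTop 0] with K hK hK0
    simp_rw [integral_surplus_inl hobs h.policy]
    rw [timeAvg_sub_const _ _ hK0]
    linarith
  -- Stability gives an eventual real bound `M` on the mean queue, so the telescoped decrease
  -- divided by `K` is asymptotically nonnegative.
  · obtain ⟨M, hM1, hM2⟩ := EReal.lt_iff_exists_real_btwn.1 (h.stable i)
    have hev := eventually_lt_of_limsup_lt hM1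
    set H : ℕ → ℝ := fun k =>
      ∫ ω, levels (queues p u₀ obs π k ω) (Sum.inl (Sum.inr i)) ∂μ with hH
    filter_upwards [hev, eventually_const_div_ge (H 0 - M) hε] with K hK hK'
    have hKM : H K < M := EReal.coe_lt_coe_iff.1 hK
    calc -ε ≤ (H 0 - M) / K := hK'
      _ ≤ (H 0 - H K) / K := by gcongr
      _ = timeAvg (fun k => H k - H (k + 1)) K := (timeAvg_telescope H K).symm
      _ ≤ _ := timeAvg_mono
          (fun k => sub_le_integral_surplus hobs.measurable h.policy h.valid hu₀ k _) K
  · have hd := h.power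
    rw [limsup_timeAvg_le_iff (integral_slotPower_mem h.policy h.valid)] at hd
    filter_upwards [hd ε hε, eventually_ne_atTop 0] with K hK hK0
    simp_rw [integral_surplus_inr h.policy h.valid]
    rw [timeAvg_const_sub _ _ hK0]
    linarith

/-- The throughput of a feasible policy does not exceed the rate of admitted packets. -/
lemma IsFeasible.eventually_admitted (hobs : IsOnOffModel μ ℱ obs lam) (hu₀ : u₀.Nonneg)
    (h : IsFeasible μ ℱ p lam u₀ obs π) {ε : ℝ} (hε : 0 < ε) :
    ∀ᶠ K in atTop, sumThroughput μ p u₀ obs π - ε ≤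
      timeAvg (fun k => ∫ ω, admitted (π k ω) ∂μ) K := by
  have hL := p.L_pos
  have hd : sumThroughput μ p u₀ obs π ≤ sumThroughput μ p u₀ obs π := le_rfl
  conv_rhs at hd => unfold sumThroughput
  rw [le_liminf_timeAvg_iff
    (sum_integral_packets_mem hobs.measurable h.policy h.valid hu₀)] at hd
  filter_upwards [hd (ε / 2) (half_pos hε), eventually_const_div_ge
    (-∑ i : N, levels u₀ (Sum.inl (Sum.inr i)) / p.L) (half_pos hε)] with K hK hK'
  rw [timeAvg_sum_integral_packets hobs.measurable h.policy h.valid hu₀] at hK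
  have h0 : 0 ≤ (∑ i : N,
      (∫ ω, levels (queues p u₀ obs π K ω) (Sum.inl (Sum.inr i)) ∂μ) / p.L) / K :=
    div_nonneg (Finset.sum_nonneg fun i _ => div_nonneg
      (integral_nonneg fun ω => levels_queues_nonneg hu₀ K ω _) hL.le) K.cast_nonneg
  rw [sub_div] at hK
  rw [neg_div] at hK'
  linarith

/-- Drift-plus-penalty bound of the algorithm against a feasible policy. -/
lemma IsAlgorithm.drift_le_of_isFeasible (hobs : IsOnOffModel μ ℱ obs lam) (hu₀ : u₀.Nonneg)
    (hB : 0 < B) (h : IsAlgorithm ℱ p B u₀ obs π) (h' : IsFeasible μ ℱ p lam u₀ obs π') (k : ℕ) :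
    ∫ ω, lyapunov (queues p u₀ obs π (k + 1) ω) ∂μ + B * p.L * sumThroughput μ p u₀ obs π' ≤
      ∫ ω, lyapunov (queues p u₀ obs π k ω) ∂μ + C1 p N
        + B * p.L * ∫ ω, admitted (π k ω) ∂μ := by
  have hBL : 0 < B * p.L := mul_pos hB p.L_pos
  set E : (R ⊕ N) ⊕ Unit → ℝ := fun c => ∫ ω, levels (queues p u₀ obs π k ω) c ∂μ with hE
  have hE0 : ∀ c, 0 ≤ E c := fun c => integral_nonneg fun ω => levels_queues_nonneg hu₀ k ω c
  -- The total weight of the competitor's long-run conditions. Allowing each an error `ε / A` costs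
  -- exactly `ε` in all.
  set A := ∑ c, E c + B * p.L with hA
  have hApos : 0 < A := add_pos_of_nonneg_of_pos (Finset.sum_nonneg fun c _ => hE0 c) hBL
  refine le_of_forall_pos_le_add fun ε hε => ?_
  have hδ : 0 < ε / A := div_pos hε hApos
  obtain ⟨J, hJ1, hJ2, hJ0⟩ := ((eventually_all.2 fun c =>
    h'.eventually_surplus hobs hu₀ c hδ).and ((h'.eventually_admitted hobs hu₀ hδ).and
      (eventually_ne_atTop 0))).exists
  -- Only the competitor's slot `j` is averaged. The slot `k` of the algorithm stays fixed, so the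
  -- mean levels `E c` are constant weights.
  have havg := timeAvg_mono (fun j => h.drift_le hobs hu₀ h'.policy h'.valid k j) J
  rw [timeAvg_const _ hJ0, timeAvg_add, timeAvg_const _ hJ0, timeAvg_add, timeAvg_sum,
    timeAvg_const_mul] at havg
  simp_rw [timeAvg_const_mul] at havg
  have h1 : ∑ c, E c * -(ε / A) ≤
      ∑ c, E c * timeAvg (fun j => ∫ ω, surplus p (obs j ω) (π' j ω) c ∂μ) J :=
    Finset.sum_le_sum fun c _ => mul_le_mul_of_nonneg_left (hJ1 c) (hE0 c)
  have h2 := mul_le_mul_of_nonneg_left hJ2 hBL.le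
  rw [← Finset.sum_mul] at h1
  have h3 : A * (ε / A) = ε := mul_div_cancel₀ _ hApos.ne'
  rw [hA, add_mul, ← hA] at h3
  linarith

lemma IsAlgorithm.lyapunov_add_le
    (hobs : IsOnOffModel μ ℱ obs lam) (hu₀ : u₀.Nonneg) (hB : 0 < B)
    (h : IsAlgorithm ℱ p B u₀ obs π) (h' : IsFeasible μ ℱ p lam u₀ obs π')
    (K : ℕ) :
    ∫ ω, lyapunov (queues p u₀ obs π K ω) ∂μ + K * (B * p.L * sumThroughput μ p u₀ obs π') ≤
      lyapunov u₀ + K * C1 p N + B * p.L * ∑ k ∈ Finset.range K, ∫ ω, admitted (π k ω) ∂μ := by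
  induction K with
  | zero => simp [queues]
  | succ K ih =>
    have := h.drift_le_of_isFeasible hobs hu₀ hB h' K
    rw [Finset.sum_range_succ]
    push_cast
    linarith

/-- Each squared level is at most twice the Lyapunov function. The summed drift bound and the
trivial bound `Fintype.card N` on admissions make its mean grow at most linearly, as
`ae_tendsto_div_zero` requires. -/
lemma IsAlgorithm.ae_tendsto_levels
    (hobs : IsOnOffModel μ ℱ obs lam) (hu₀ : u₀.Nonneg) (hB : 0 < B)
    (h : IsAlgorithm ℱ p B u₀ obs π) (h' : IsFeasible μ ℱ p lam u₀ obs π')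
    (c : (R ⊕ N) ⊕ Unit) :
    ∀ᵐ ω ∂μ, Tendsto (fun k : ℕ => levels (queues p u₀ obs π k ω) c / k) atTop (𝓝 0) := by
  have hBL : 0 < B * p.L := mul_pos hB p.L_pos
  have hval := h.valid hu₀
  have hm := hobs.measurable
  refine ae_tendsto_div_zero (M := √(2 * C1 p N)) (a := 2 * lyapunov u₀)
    (b := 2 * (C1 p N + B * p.L * Fintype.card N - B * p.L * sumThroughput μ p u₀ obs π'))
    (measurable_levels_queues hm h.policy · c) (levels_queues_nonneg hu₀ · · c)
    (levels_queues_succ_le hval hu₀ · · c) (Real.sqrt_nonneg _)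
    (integrable_levels_sq hm h.policy hval hu₀ · c)
    (mul_nonneg zero_le_two (div_nonneg (Finset.sum_nonneg fun _ _ => sq_nonneg _) zero_le_two))
    fun k => ?_
  have h1 : ∫ ω, levels (queues p u₀ obs π k ω) c ^ 2 ∂μ ≤
      2 * ∫ ω, lyapunov (queues p u₀ obs π k ω) ∂μ := by
    rw [← integral_const_mul]
    refine integral_mono (integrable_levels_sq hm h.policy hval hu₀ k c)
      ((integrable_lyapunov hm h.policy hval hu₀ k).const_mul 2) fun ω => ?_
    simp only [lyapunov, mul_div_cancel₀ _ (two_ne_zero : (2 : ℝ) ≠ 0)]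
    exact Finset.single_le_sum (f := fun c => levels (queues p u₀ obs π k ω) c ^ 2)
      (fun c _ => sq_nonneg _) (Finset.mem_univ c)
  have h2 := h.lyapunov_add_le hobs hu₀ hB h' k
  have h3 : ∑ j ∈ Finset.range k, ∫ ω, admitted (π j ω) ∂μ ≤ k * Fintype.card N := by
    calc _ ≤ ∑ _j ∈ Finset.range k, (Fintype.card N : ℝ) := Finset.sum_le_sum fun j _ =>
          (integral_mem_Icc (measurable_admitted (h.policy.measurable' j))
            fun _ => admitted_mem _).2
      _ = _ := by simp
  have h4 := mul_le_mul_of_nonneg_left h3 hBL.le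
  linarith

lemma IsAlgorithm.tendsto_integral_levels
    (hobs : IsOnOffModel μ ℱ obs lam) (hu₀ : u₀.Nonneg) (hB : 0 < B)
    (h : IsAlgorithm ℱ p B u₀ obs π) (h' : IsFeasible μ ℱ p lam u₀ obs π')
    (c : (R ⊕ N) ⊕ Unit) :
    Tendsto (fun k : ℕ => (∫ ω, levels (queues p u₀ obs π k ω) c ∂μ) / k) atTop (𝓝 0) :=
  tendsto_integral_div_zero (measurable_levels_queues hobs.measurable h.policy · c)
    (levels_queues_nonneg hu₀ · · c) (levels_queues_le (h.valid hu₀) hu₀ · · c)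
    (levels_nonneg hu₀ c) (Real.sqrt_nonneg _) (h.ae_tendsto_levels hobs hu₀ hB h' c)

end Performance

/-! ### Constraints and throughput of the algorithm -/

section Main

variable {R N Ω : Type*} [Fintype R] [Fintype N] [mΩ : MeasurableSpace Ω] {μ : Measure Ω}
  [IsProbabilityMeasure μ] {ℱ : Filtration ℕ mΩ} {p : Params R} {lam : R → ℝ} {B : ℝ}
  {obs : ℕ → Ω → Slot R N} {u₀ : State R N} {π π' : ℕ → Ω → Action R N}

/-- Law of large numbers for the arrivals. -/
lemma IsOnOffModel.ae_tendsto_arrival (hobs : IsOnOffModel μ ℱ obs lam) (i : R) :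
    ∀ᵐ ω ∂μ, Tendsto (timeAvg fun k => ind ((obs k ω).1 (Sum.inl i))) atTop (𝓝 (lam i)) := by
  have hm : Measurable fun s : Slot R N => ind (s.1 (Sum.inl i)) :=
    measurable_arrival measurable_id _
  -- An earlier observation is known in slot `k - 1`, and `obs k` is independent of that
  -- information. The strong law used here needs only pairwise independence.
  have hlt : ∀ j k, j < k → IndepFun (obs k) (obs j) μ := by
    intro j k hjk
    obtain ⟨k, rfl⟩ := Nat.exists_eq_succ_of_ne_zero (Nat.ne_zero_of_lt hjk)
    rw [IndepFun_iff_Indep]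
    exact indep_of_indep_of_le_right (hobs.indep k)
      (((hobs.measurable j).mono (ℱ.mono (Nat.lt_succ_iff.1 hjk)) le_rfl).comap_le)
  have hpair : Pairwise fun j k => IndepFun (obs j) (obs k) μ := by
    intro j k hjk
    rcases lt_or_gt_of_ne hjk with hlt' | hlt'
    · exact (hlt j k hlt').symm
    · exact hlt k j hlt'
  have key := strong_law_ae_real (μ := μ) (fun k ω => ind ((obs k ω).1 (Sum.inl i)))
    (integrable_of_mem_Icc (hm.comp ((hobs.measurable 0).mono (ℱ.le 0) le_rfl))
      fun _ => ⟨ind_nonneg _, ind_le_one _⟩)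
    (fun j k hjk => (hpair hjk).comp hm hm) (fun k => (hobs.identDistrib k).comp hm)
  rwa [integral_arrival hobs] at key

lemma sub_le_surplus (k : ℕ) (ω : Ω) (c) :
    levels (queues p u₀ obs π k ω) c - levels (queues p u₀ obs π (k + 1) ω) c ≤
      surplus p (obs k ω) (π k ω) c := by
  rw [levels_queues_succ]
  linarith [le_max_left (levels (queues p u₀ obs π k ω) c - surplus p (obs k ω) (π k ω) c) 0]

/-- If a queue is rate stable, its service has at least the average of its arrivals. -/
lemma le_liminf_timeAvg_of_tendsto {f g l : ℕ → ℝ} {a b x : ℝ} (hf : ∀ k, f k ∈ Set.Icc a b)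
    (hg : Tendsto (timeAvg g) atTop (𝓝 x)) (hl : Tendsto (fun k : ℕ => l k / k) atTop (𝓝 0))
    (h : ∀ k, l k - l (k + 1) ≤ f k - g k) : x ≤ liminf (timeAvg f) atTop := by
  rw [le_liminf_timeAvg_iff hf]
  intro ε hε
  have hlim : Tendsto (fun K => (l 0 / K - l K / K) + timeAvg g K) atTop (𝓝 x) := by
    simpa using ((tendsto_const_div_atTop_nhds_zero_nat (l 0)).sub hl).add hg
  filter_upwards [hlim.eventually_const_le (by linarith : x - ε < x)] with K hK
  have := timeAvg_mono h K
  rw [timeAvg_telescope, timeAvg_sub, sub_div] at this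
  linarith

lemma limsup_timeAvg_le_of_tendsto {f l : ℕ → ℝ} {a b x : ℝ} (hf : ∀ k, f k ∈ Set.Icc a b)
    (hl : Tendsto (fun k : ℕ => l k / k) atTop (𝓝 0))
    (h : ∀ k, l k - l (k + 1) ≤ x - f k) : limsup (timeAvg f) atTop ≤ x := by
  rw [limsup_timeAvg_le_iff hf]
  intro ε hε
  have hlim : Tendsto (fun K : ℕ => l 0 / K - l K / K) atTop (𝓝 0) := by
    simpa using (tendsto_const_div_atTop_nhds_zero_nat (l 0)).sub hl
  filter_upwards [hlim.eventually_const_le (by linarith : -ε < 0), eventually_ne_atTop 0]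
    with K hK hK0
  have := timeAvg_mono h K
  rw [timeAvg_telescope, timeAvg_const_sub _ _ hK0, sub_div] at this
  linarith

lemma tendsto_timeAvg_const (x : ℝ) : Tendsto (timeAvg fun _ => x) atTop (𝓝 x) :=
  tendsto_const_nhds.congr' ((eventually_ne_atTop 0).mono fun _ hK => (timeAvg_const x hK).symm)

/-- Admission control keeps the data queues bounded. -/
lemma IsAlgorithm.levels_le (hu₀ : u₀.Nonneg) (h : IsAlgorithm ℱ p B u₀ obs π) (i : N) (k : ℕ)
    (ω : Ω) :
    levels (queues p u₀ obs π k ω) (Sum.inl (Sum.inr i)) ≤ max (u₀.Q i) (B + p.L) := by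
  induction k with
  | zero => exact le_max_left _ _
  | succ k ih =>
    have hQ0 := levels_queues_nonneg (p := p) (obs := obs) (π := π) hu₀ k ω (Sum.inl (Sum.inr i))
    obtain ⟨-, -, -, -, -, -, -, -, -, hadm⟩ := h.decision k ω
    have hb := (nrtBits_mem (h.valid hu₀ k ω) (Sum.inr i)).1
    rw [levels_queues_succ]
    refine max_le ?_ (hQ0.trans ih)
    have hs : surplus p (obs k ω) (π k ω) (Sum.inl (Sum.inr i)) =
      (π k ω).dur (Sum.inr i) * rate (obs k ω) (π k ω) (Sum.inr i)
        - p.L * ind ((π k ω).adm i) := rfl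
    rw [hs, hadm i]
    change (queues p u₀ obs π k ω).Q i ≤ _ at ih
    change (queues p u₀ obs π k ω).Q i - _ ≤ _
    -- A queue below `B` grows by at most one packet, and any other queue does not grow.
    split_ifs with hlt
    · have := mul_le_of_le_one_right p.L_pos.le (ind_le_one ((obs k ω).1 (Sum.inr i)))
      exact le_max_of_le_right (by linarith)
    · simp only [ind, Bool.false_eq_true, if_false, mul_zero, sub_zero]
      linarith

/-- Stability comes from admission control alone. Delivery and power follow from the mean
sublinearity of the virtual queues, which is where a feasible competitor is needed. -/
lemma IsAlgorithm.isFeasible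
    (hobs : IsOnOffModel μ ℱ obs lam) (hu₀ : u₀.Nonneg) (hB : 0 < B)
    (h : IsAlgorithm ℱ p B u₀ obs π) (h' : IsFeasible μ ℱ p lam u₀ obs π') :
    IsFeasible μ ℱ p lam u₀ obs π := by
  have hval := h.valid hu₀
  refine ⟨h.policy, hval, fun i => ?_, fun i => ?_, ?_⟩
  · refine lt_of_le_of_lt (limsup_le_of_le (a := ((max (u₀.Q i) (B + p.L) : ℝ) : EReal))
      (h := Eventually.of_forall fun k => ?_)) (EReal.coe_lt_top _)
    refine EReal.coe_le_coe_iff.2 ?_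
    exact (integral_mem_Icc (measurable_levels_queues hobs.measurable h.policy k
      (Sum.inl (Sum.inr i))) fun ω => ⟨levels_queues_nonneg hu₀ k ω _, h.levels_le hu₀ i k ω⟩).2
  · simp_rw [packets_inl hval]
    refine le_liminf_timeAvg_of_tendsto (integral_served_mem h.policy i)
      (tendsto_timeAvg_const (lam i * p.q i))
      (h.tendsto_integral_levels hobs hu₀ hB h' (Sum.inl (Sum.inl i))) fun k => ?_
    rw [← integral_surplus_inl hobs h.policy]
    exact sub_le_integral_surplus hobs.measurable h.policy hval hu₀ k _
  · refine limsup_timeAvg_le_of_tendsto (integral_slotPower_mem h.policy hval)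
      (h.tendsto_integral_levels hobs hu₀ hB h' (Sum.inr ())) fun k => ?_
    rw [← integral_surplus_inr h.policy hval]
    exact sub_le_integral_surplus hobs.measurable h.policy hval hu₀ k _

/-- Pathwise, rate stability of `Y` compares deliveries with the empirical arrivals `a_i * q_i`; the
law of large numbers turns their average into `lam i * q_i`. -/
lemma IsAlgorithm.ae_delivery
    (hobs : IsOnOffModel μ ℱ obs lam) (hu₀ : u₀.Nonneg) (hB : 0 < B)
    (h : IsAlgorithm ℱ p B u₀ obs π) (h' : IsFeasible μ ℱ p lam u₀ obs π')
    (i : R) :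
    ∀ᵐ ω ∂μ, lam i * p.q i ≤
      liminf (timeAvg fun k => packets p u₀ obs π (Sum.inl i) k ω) atTop := by
  filter_upwards [h.ae_tendsto_levels hobs hu₀ hB h' (Sum.inl (Sum.inl i)),
    hobs.ae_tendsto_arrival i] with ω hω hω'
  simp_rw [packets_inl (h.valid hu₀)]
  refine le_liminf_timeAvg_of_tendsto (fun k => served_mem (π k ω) i)
    (g := fun k => ind ((obs k ω).1 (Sum.inl i)) * p.q i) ?_ hω
    fun k => sub_le_surplus k ω (Sum.inl (Sum.inl i))
  refine (hω'.mul_const (p.q i)).congr fun K => ?_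
  rw [mul_comm, ← timeAvg_const_mul]
  simp_rw [mul_comm]

lemma IsAlgorithm.ae_power
    (hobs : IsOnOffModel μ ℱ obs lam) (hu₀ : u₀.Nonneg) (hB : 0 < B)
    (h : IsAlgorithm ℱ p B u₀ obs π) (h' : IsFeasible μ ℱ p lam u₀ obs π') :
    ∀ᵐ ω ∂μ, limsup (timeAvg fun k => slotPower p (π k ω)) atTop ≤ p.Pavg := by
  filter_upwards [h.ae_tendsto_levels hobs hu₀ hB h' (Sum.inr ())] with ω hω
  exact limsup_timeAvg_le_of_tendsto (fun k => slotPower_mem (h.valid hu₀ k ω)) hω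
    fun k => sub_le_surplus k ω (Sum.inr ())

lemma IsAlgorithm.sumThroughput_ge
    (hobs : IsOnOffModel μ ℱ obs lam) (hu₀ : u₀.Nonneg) (hB : 0 < B)
    (h : IsAlgorithm ℱ p B u₀ obs π) (h' : IsFeasible μ ℱ p lam u₀ obs π') :
    sumThroughput μ p u₀ obs π' - C1 p N / (p.L * B) ≤ sumThroughput μ p u₀ obs π := by
  have hval := h.valid hu₀
  have hL := p.L_pos
  have hBL : 0 < B * p.L := mul_pos hB hL
  have hm := hobs.measurable
  conv_rhs => unfold sumThroughput
  rw [le_liminf_timeAvg_iff (sum_integral_packets_mem hm h.policy hval hu₀)]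
  intro ε hε
  set θ := sumThroughput μ p u₀ obs π'
  set Hb : ℝ := ∑ i : N, max (u₀.Q i) (B + p.L) / p.L with hHb
  filter_upwards [eventually_const_div_ge (-Hb) (half_pos hε),
    eventually_const_div_ge (-(lyapunov u₀ / (B * p.L))) (half_pos hε), eventually_gt_atTop 0]
    with K hK1 hK2 hK0
  have hK0' : (0 : ℝ) < K := by exact_mod_cast hK0
  rw [timeAvg_sum_integral_packets hm h.policy hval hu₀]
  have h0 : 0 ≤ ∑ i : N, levels u₀ (Sum.inl (Sum.inr i)) / p.L :=
    Finset.sum_nonneg fun i _ => div_nonneg (levels_nonneg hu₀ _) hL.le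
  have h1 : ∑ i : N, (∫ ω, levels (queues p u₀ obs π K ω) (Sum.inl (Sum.inr i)) ∂μ) / p.L
      ≤ Hb := Finset.sum_le_sum fun i _ => div_le_div_of_nonneg_right
    (integral_mem_Icc (measurable_levels_queues hm h.policy K
      (Sum.inl (Sum.inr i))) fun ω => ⟨levels_queues_nonneg hu₀ K ω _, h.levels_le hu₀ i K ω⟩).2
    hL.le
  have h2 : -Hb / K ≤ (∑ i : N, levels u₀ (Sum.inl (Sum.inr i)) / p.L
      - ∑ i : N, (∫ ω, levels (queues p u₀ obs π K ω) (Sum.inl (Sum.inr i)) ∂μ) / p.L) / K := by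
    gcongr
    linarith
  -- The summed drift bound divided by `B * L * K`, with the nonnegative final Lyapunov value
  -- dropped. The initial value leaves only a term of order `1 / K`.
  have h3 : θ - C1 p N / (p.L * B) - lyapunov u₀ / (B * p.L) / K ≤
      timeAvg (fun k => ∫ ω, admitted (π k ω) ∂μ) K := by
    have hsum := h.lyapunov_add_le hobs hu₀ hB h' K
    have hV : 0 ≤ ∫ ω, lyapunov (queues p u₀ obs π K ω) ∂μ :=
      integral_nonneg fun ω => div_nonneg (Finset.sum_nonneg fun _ _ => sq_nonneg _) zero_le_two
    rw [timeAvg, le_div_iff₀ hK0']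
    have e : (θ - C1 p N / (p.L * B) - lyapunov u₀ / (B * p.L) / K) * K =
        (K * (B * p.L * θ) - K * C1 p N - lyapunov u₀) / (B * p.L) := by
      field_simp
    rw [e, div_le_iff₀ hBL]
    linarith
  rw [neg_div] at hK2
  linarith

end Main

end RTNRT

theorem mainTheorem1 {R N Ω : Type*} [Fintype R] [Fintype N] [Nonempty N]
    [mΩ : MeasurableSpace Ω] (μ : Measure Ω) [IsProbabilityMeasure μ] (ℱ : Filtration ℕ mΩ)
    (p : RTNRT.Params R) (lam : R → ℝ) (obs : ℕ → Ω → RTNRT.Slot R N)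
    (hobs : RTNRT.IsOnOffModel μ ℱ obs lam)
    (u₀ : RTNRT.State R N) (hu₀ : u₀.Nonneg)
    (hfeas : ∃ π, RTNRT.IsFeasible μ ℱ p lam u₀ obs π)
    (B : ℝ) (hB : 0 < B) :
    (∃ π, RTNRT.IsAlgorithm ℱ p B u₀ obs π) ∧
    ∀ π, RTNRT.IsAlgorithm ℱ p B u₀ obs π →
      RTNRT.IsFeasible μ ℱ p lam u₀ obs π ∧
      (∀ i : R, ∀ᵐ ω ∂μ, lam i * p.q i ≤
        liminf (RTNRT.timeAvg fun k => RTNRT.packets p u₀ obs π (Sum.inl i) k ω) atTop) ∧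
      (∀ᵐ ω ∂μ, limsup (RTNRT.timeAvg fun k => RTNRT.slotPower p (π k ω)) atTop ≤ p.Pavg) ∧
      RTNRT.optThroughput μ ℱ p lam u₀ obs - RTNRT.C1 p N / (p.L * B) ≤
        RTNRT.sumThroughput μ p u₀ obs π := by
  refine ⟨RTNRT.exists_isAlgorithm ℱ p B hu₀ hobs.measurable, fun π h => ?_⟩
  obtain ⟨π₀, h₀⟩ := hfeas
  refine ⟨h.isFeasible hobs hu₀ hB h₀, h.ae_delivery hobs hu₀ hB h₀, h.ae_power hobs hu₀ hB h₀, ?_⟩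
  rw [sub_le_iff_le_add]
  -- Feasibility makes the set nonempty, as a bound on a real supremum requires; the estimate itself
  -- holds against each competitor separately.
  refine csSup_le ⟨_, π₀, h₀, rfl⟩ ?_
  rintro _ ⟨π', h', rfl⟩
  rw [← sub_le_iff_le_add]
  exact h.sumThroughput_ge hobs hu₀ hB h'
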